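/- Conventions. Ordered rooted trees are finite, of arbitrary arity. In a straight-line drawing the nodes are placed at points of $\mathbb{Z}^2$ (the $y$-coordinate grows upward) and edges are straight segments. A drawing is planar if distinct nodes lie at distinct points, no node lies in the interior of an edge, and the interiors of distinct edges are disjoint; it is order-preserving if around every node the edges to its parent (if it has one) and to its children, in their given left-to-right order, appear in this counterclockwise cyclic order. The width (height) is the number of grid columns (grid rows) that meet the drawing, i.e. its bounding box. For a root-to-leaf path $\pi=\langle v_1,\dots,v_\ell\rangle$ a left (right) subtree of $\pi$ is a subtree rooted at a child of some $v_i$, $i<\ell$, that comes before (after) $v_{i+1}$ in the order of children of $v_i$. A GLR-drawing of $T$ is a planar order-preserving drawing such that for every node $v$ of $T$ the induced drawing of the subtree $T_v$ rooted at $v$ satisfies: some root-to-leaf path $\pi=\langle v_1,\dots,v_\ell\rangle$ of $T_v$ is drawn in one column, with $v_i$ above $v_{i+1}$ for $1\le i<\ell$, and this column separates the left from the right subtrees of $\pi$, i.e. all left subtrees are drawn strictly to the left of it and all right subtrees strictly to the right of it. A drawing is of type I if the root is in the top row; of type II$\ell$ (II$r$) if the root is in the leftmost (rightmost) column and no node lies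 above the root in that column. Statement. Let $p=0.48$. There is a constant $c>0$ such that every ordered rooted tree $T$ with $n$ nodes has (1) a straight-line GLR-drawing (not necessarily upward) of type I, of width at most $cn^p-1$ and height exactly $n$; (2) a straight-line GLR-drawing (not necessarily upward) of type II$\ell$, of width at most $cn^p$ and height exactly $n$; and (3) a straight-line GLR-drawing (not necessarily upward) of type II$r$, of width at most $cn^p$ and height exactly $n$. The constant $c$ is the same in all three parts and does not depend on $T$ or $n$. -/

import Mathlib

/-- Finite ordered rooted trees: a root together with the ordered list (from left to right) of the
subtrees rooted at its children. There is no bound on the number of children. -/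
inductive OrderedTree where
  | node (children : List OrderedTree) : OrderedTree

namespace OrderedTree

/-- The number of nodes. -/
def size : OrderedTree → ℕ
  | node cs => 1 + (cs.map size).sum

/-- A node is addressed by the list of child indices along the path from the root to it: `[]` is
the root, and `a ++ [i]` is the `i`-th child (counted from `0`, left to right) of the node `a`.
`T.IsNode a` says that `a` is the address of a node of `T`. -/
def IsNode : OrderedTree → List ℕ → Prop
  | _, [] => True
  | node cs, i :: a => ∃ t, cs[i]? = some t ∧ IsNode t a

/-- A leaf is a node without children. -/
def IsLeaf (T : OrderedTree) (a : List ℕ) : Prop :=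
  T.IsNode a ∧ ∀ i, ¬ T.IsNode (a ++ [i])

/-- A straight-line grid drawing is given by the positions of the nodes. Points are
`(column, row)`, i.e. `(x, y)`, and `y` grows upward. Values at addresses that are not nodes of the
tree are never used. -/
abbrev Placement : Type := List ℕ → ℤ × ℤ

/-- A grid point as a point of the plane. -/
def toPlane (p : ℤ × ℤ) : ℝ × ℝ := ((p.1 : ℝ), (p.2 : ℝ))

/-- The edge from the node `a` to its `i`-th child, without its end points. -/
def openEdge (pos : Placement) (a : List ℕ) (i : ℕ) : Set (ℝ × ℝ) :=
  openSegment ℝ (toPlane (pos a)) (toPlane (pos (a ++ [i])))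

/-- The straight-line drawing of `T` is planar: distinct nodes are at distinct points, no node
lies in the interior of an edge, and the interiors of distinct edges are disjoint. -/
structure IsPlanar (T : OrderedTree) (pos : Placement) : Prop where
  inj : ∀ a b, T.IsNode a → T.IsNode b → pos a = pos b → a = b
  node_edge : ∀ a b i, T.IsNode a → T.IsNode (b ++ [i]) → toPlane (pos a) ∉ openEdge pos b i
  edge_edge : ∀ a i b j, T.IsNode (a ++ [i]) → T.IsNode (b ++ [j]) → (a, i) ≠ (b, j) →
    Disjoint (openEdge pos a i) (openEdge pos b j)

/-- The cross product (determinant) of two plane vectors; it is positive iff the counterclockwise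
angle from `u` to `v` lies strictly between `0` and `π`. -/
def cross (u v : ℤ × ℤ) : ℤ := u.1 * v.2 - u.2 * v.1

/-- The vectors `u`, `v`, `w` have pairwise distinct directions, and turning counterclockwise from
`u` one meets the direction of `v` before that of `w`. (The three consecutive counterclockwise
angles are then positive with sum `2π`, so at least two of them are less than `π`; in every other
case at most one of the three cross products is positive.) -/
def CCW (u v w : ℤ × ℤ) : Prop :=
  (0 < cross u v ∧ 0 < cross v w) ∨ (0 < cross v w ∧ 0 < cross w u) ∨
    (0 < cross w u ∧ 0 < cross u v)

/-- The vector from the node `a` to the node `b`. -/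
def dir (pos : Placement) (a b : List ℕ) : ℤ × ℤ := pos b - pos a

/-- The drawing is order-preserving: around each node, the edges to its parent (if the node is not
the root) and to its children from left to right appear in this counterclockwise cyclic order. -/
structure IsOrderPreserving (T : OrderedTree) (pos : Placement) : Prop where
  children : ∀ a i j k, i < j → j < k → T.IsNode (a ++ [k]) →
    CCW (dir pos a (a ++ [i])) (dir pos a (a ++ [j])) (dir pos a (a ++ [k]))
  parent : ∀ a h i j, i < j → T.IsNode (a ++ [h] ++ [j]) →
    CCW (dir pos (a ++ [h]) a) (dir pos (a ++ [h]) (a ++ [h] ++ [i]))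
      (dir pos (a ++ [h]) (a ++ [h] ++ [j]))

/-- The path from the node `a` down to the leaf `b` (that is, a root-to-leaf path of the subtree
rooted at `a`) is drawn in one column, with each node above the next one, and this column separates
the left subtrees of the path from its right subtrees. A left (right) subtree of the path is a
subtree rooted at a child of a path node that comes before (after) the path-child of that node.
All nodes of left subtrees lie strictly left of the column of the path and all nodes of right
subtrees strictly right of it; the same then holds for the edges of these subtrees. -/
structure IsGLRPath (T : OrderedTree) (pos : Placement) (a b : List ℕ) : Prop where
  leaf : T.IsLeaf b
  down : a <+: b
  vertical : ∀ v i, a <+: v → v ++ [i] <+: b →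
    (pos (v ++ [i])).1 = (pos v).1 ∧ (pos (v ++ [i])).2 < (pos v).2
  left : ∀ v i j w, a <+: v → v ++ [i] <+: b → j < i → v ++ [j] <+: w → T.IsNode w →
    (pos w).1 < (pos a).1
  right : ∀ v i j w, a <+: v → v ++ [i] <+: b → i < j → v ++ [j] <+: w → T.IsNode w →
    (pos a).1 < (pos w).1

/-- Straight-line generalized LR-drawings: planar and order-preserving, and the induced drawing of
every rooted subtree (in particular the drawing of the whole tree) has a vertical root-to-leaf path
that separates the left subtrees of the path from its right subtrees. -/
structure IsGLRDrawing (T : OrderedTree) (pos : Placement) : Prop where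
  planar : T.IsPlanar pos
  ordered : T.IsOrderPreserving pos
  path : ∀ a, T.IsNode a → ∃ b, T.IsGLRPath pos a b

/-- Type I: the root is in the top row. -/
def IsTypeI (T : OrderedTree) (pos : Placement) : Prop :=
  ∀ a, T.IsNode a → (pos a).2 ≤ (pos []).2

/-- No node lies above the root in the column of the root. -/
def FreeAboveRoot (T : OrderedTree) (pos : Placement) : Prop :=
  ∀ a, T.IsNode a → (pos a).1 = (pos []).1 → (pos a).2 ≤ (pos []).2

/-- Type IIℓ: the root is in the leftmost column, with no node above it in that column. -/
def IsTypeIIl (T : OrderedTree) (pos : Placement) : Prop :=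
  (∀ a, T.IsNode a → (pos []).1 ≤ (pos a).1) ∧ T.FreeAboveRoot pos

/-- Type IIr: the root is in the rightmost column, with no node above it in that column. -/
def IsTypeIIr (T : OrderedTree) (pos : Placement) : Prop :=
  (∀ a, T.IsNode a → (pos a).1 ≤ (pos []).1) ∧ T.FreeAboveRoot pos

/-- The width: the number of columns (vertical grid lines) that meet the drawing, i.e. its
bounding box. -/
noncomputable def width (T : OrderedTree) (pos : Placement) : ℕ :=
  {x : ℤ | ∃ a b, T.IsNode a ∧ T.IsNode b ∧ (pos a).1 ≤ x ∧ x ≤ (pos b).1}.ncard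

/-- The height: the number of rows (horizontal grid lines) that meet the drawing, i.e. its
bounding box. -/
noncomputable def height (T : OrderedTree) (pos : Placement) : ℕ :=
  {y : ℤ | ∃ a b, T.IsNode a ∧ T.IsNode b ∧ (pos a).2 ≤ y ∧ y ≤ (pos b).2}.ncard

end OrderedTree

namespace OrderedTree

/-! All three types are constructed by one simultaneous induction on the number $n$ of nodes, with
$p=0.48$ and $c=20000$. Every drawing gives each root subtree its own block of consecutive rows and
the root its own row, so the height is exactly $n$ and different subtrees cannot meet; only the
edges at the root need care (`Stacking`).

Type I rests on the path lemma `exists_sizeSpine`: some root-to-leaf path has left subtrees of size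
at most $a$ and right subtrees of size at most $b$, where $a^p+b^p\le 0.9999\,n^p$. The path is
drawn in one column. Left subtrees are drawn with type II$r$ and right subtrees with type II$\ell$,
their roots in the columns next to the path. The width is at most $c a^p+c b^p+1\le c n^p-1$,
because $0.0001\,c=2$.

Type II$\ell$ follows the leftmost path. At each of its nodes at most one right subtree has more
than $n/2$ nodes. That one is drawn with type I in the rows directly below the node, so that its
edge joins consecutive rows and may be arbitrarily long horizontally; the spare column in the type I
bound pays for the column of the path. The other right subtrees are drawn with type II$\ell$ in the
next column, with width at most $0.76\,c n^p$. Type II$r$ is the mirror image.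

The path lemma comes from a greedy search that keeps the maximal sizes $\alpha$, $\beta$ pruned on
the left and on the right. If the search gets stuck, a path that turns into the most recently
recorded record part succeeds; this is a numerical fact about concave powers
(`split_certificate_main`, `split_certificate_side`) and is what fixes the admissible exponent. -/

/-! ### Paths whose side subtrees are small. -/

/-- `Spine L R T`: some root-to-leaf path of `T` has only left subtrees satisfying `L` and only right
subtrees satisfying `R`. -/
inductive Spine (L R : OrderedTree → Prop) : OrderedTree → Prop
  | leaf : Spine L R (node [])
  | step (l : List OrderedTree) (t : OrderedTree) (r : List OrderedTree) :
      (∀ s ∈ l, L s) → (∀ s ∈ r, R s) → Spine L R t → Spine L R (node (l ++ t :: r))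

theorem Spine.mono {L R L' R' : OrderedTree → Prop} (hL : ∀ s, L s → L' s) (hR : ∀ s, R s → R' s)
    {T : OrderedTree} (h : Spine L R T) : Spine L' R' T := by
  induction h with
  | leaf => exact .leaf
  | step l t r hl hr _ ih =>
    exact .step l t r (fun s hs => hL s (hl s hs)) (fun s hs => hR s (hr s hs)) ih

theorem size_node (cs : List OrderedTree) : (node cs).size = 1 + (cs.map size).sum := by
  rw [size]

theorem size_pos (T : OrderedTree) : 0 < T.size := by
  cases T; rw [size_node]; omega

theorem size_le_sum {s : OrderedTree} {cs : List OrderedTree} (h : s ∈ cs) :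
    s.size ≤ (cs.map size).sum :=
  List.le_sum_of_mem (List.mem_map_of_mem h)

/-- A path with left subtrees of size at most `a` and right subtrees of size at most `b`. -/
abbrev SizeSpine (a b : ℕ) (T : OrderedTree) : Prop :=
  Spine (fun s => s.size ≤ a) (fun s => s.size ≤ b) T

/-- A tree of the list together with a path in it such that the trees to the left (right) of the
path have size at most `a` (at most `b`). -/
def ForestSpine (a b : ℕ) (cs : List OrderedTree) : Prop :=
  ∃ l t r, cs = l ++ t :: r ∧ (∀ s ∈ l, s.size ≤ a) ∧ (∀ s ∈ r, s.size ≤ b) ∧ SizeSpine a b t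

theorem ForestSpine.sizeSpine {a b : ℕ} {cs : List OrderedTree} (h : ForestSpine a b cs) :
    SizeSpine a b (node cs) := by
  obtain ⟨l, t, r, rfl, hl, hr, ht⟩ := h
  exact .step l t r hl hr ht

/-- The rightmost path has no right subtrees, so `b` plays no role. -/
theorem sizeSpine_rightmost (a b : ℕ) : ∀ (n : ℕ) (T : OrderedTree), T.size ≤ n → T.size ≤ a →
    SizeSpine a b T
  | 0, T, h, _ => absurd T.size_pos (by omega)
  | n + 1, node cs, h, ha => by
    rw [size_node] at h ha
    rcases List.eq_nil_or_concat' cs with rfl | ⟨l, t, rfl⟩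
    · exact .leaf
    · have ht := size_le_sum (s := t) (cs := l ++ [t]) (by simp)
      exact .step l t [] (fun s hs => (size_le_sum (cs := l ++ [t]) (by simp [hs])).trans (by omega))
        (by simp) (sizeSpine_rightmost a b n t (by omega) (by omega))

theorem sizeSpine_leftmost (a b : ℕ) : ∀ (n : ℕ) (T : OrderedTree), T.size ≤ n → T.size ≤ b →
    SizeSpine a b T
  | 0, T, h, _ => absurd T.size_pos (by omega)
  | n + 1, node [], _, _ => .leaf
  | n + 1, node (t :: r), h, hb => by
    rw [size_node] at h hb
    have ht := size_le_sum (s := t) (cs := t :: r) (by simp)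
    exact .step [] t r (by simp)
      (fun s hs => (size_le_sum (cs := t :: r) (by simp [hs])).trans (by omega))
      (sizeSpine_leftmost a b n t (by omega) (by omega))

theorem forestSpine_head {a b : ℕ} {t : OrderedTree} {ts : List OrderedTree}
    (hb : (ts.map size).sum ≤ b) (h : SizeSpine a b t) : ForestSpine a b (t :: ts) :=
  ⟨[], t, ts, rfl, by simp, fun _ hs => (size_le_sum hs).trans hb, h⟩

theorem forestSpine_tail {a b : ℕ} {t : OrderedTree} {ts : List OrderedTree}
    (ha : t.size ≤ a) (h : ForestSpine a b ts) : ForestSpine a b (t :: ts) := by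
  obtain ⟨l, s, r, rfl, hl, hr, hs⟩ := h
  refine ⟨t :: l, s, r, rfl, ?_, hr, hs⟩
  simpa using ⟨ha, hl⟩

theorem forestSpine_rightmost {a : ℕ} (b : ℕ) {cs : List OrderedTree} (hne : cs ≠ [])
    (ha : (cs.map size).sum ≤ a) : ForestSpine a b cs := by
  rcases List.eq_nil_or_concat' cs with rfl | ⟨l, t, rfl⟩
  · exact absurd rfl hne
  · refine ⟨l, t, [], rfl, fun s hs => (size_le_sum (cs := l ++ [t]) (by simp [hs])).trans ha,
      by simp, sizeSpine_rightmost a b _ t le_rfl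
        ((size_le_sum (cs := l ++ [t]) (by simp)).trans ha)⟩

/-! ### Numerical inequalities for the exponent 0.48. -/

/-- The tangent of the concave power at `x₀`, by weighted AM-GM. Since 0.48 = 12/25, the hypothesis
`h` says that `q` bounds `x₀ ^ 0.48` from above, in a form that rational arithmetic can check. -/
theorem rpow_le_tangent {x x₀ q : ℝ} (hx : 0 ≤ x) (h₀ : 0 < x₀) (hq : 0 ≤ q)
    (h : x₀ ^ 12 ≤ q ^ 25) : x ^ (0.48 : ℝ) ≤ q * (0.52 + 0.48 * (x / x₀)) := by
  have h1 : x₀ ^ (0.48 : ℝ) ≤ q := by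
    have : (x₀ ^ (0.48 : ℝ)) ^ 25 ≤ q ^ 25 := by
      rw [← Real.rpow_natCast, ← Real.rpow_mul h₀.le]
      refine le_trans (le_of_eq ?_) h
      rw [← Real.rpow_natCast]; norm_num
    exact le_of_pow_le_pow_left₀ (by norm_num) hq this
  have h2 : (x / x₀) ^ (0.48 : ℝ) ≤ 0.52 + 0.48 * (x / x₀) := by
    have := Real.geom_mean_le_arith_mean2_weighted (w₁ := 0.48) (w₂ := 0.52) (by norm_num)
      (by norm_num) (div_nonneg hx h₀.le) zero_le_one (by norm_num)
    simp only [Real.one_rpow, mul_one] at this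
    linarith
  calc x ^ (0.48 : ℝ) = x₀ ^ (0.48 : ℝ) * (x / x₀) ^ (0.48 : ℝ) := by
        rw [← Real.mul_rpow h₀.le (div_nonneg hx h₀.le), mul_div_cancel₀ _ h₀.ne']
    _ ≤ q * (0.52 + 0.48 * (x / x₀)) :=
        mul_le_mul h1 h2 (Real.rpow_nonneg (div_nonneg hx h₀.le) _) hq

/-- A positive combination of the three sums of powers is concave, and the base points below are, up
to rounding, its maximizer under the linear constraints. There the tangent slopes cancel against the
constraints, so linear arithmetic shows that the three sums cannot all exceed 0.9999. -/
theorem split_certificate_main {α β l r t s : ℝ} (hα : 0 ≤ α) (hβ : 0 ≤ β) (hl : 0 ≤ l) (hr : 0 ≤ r)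
    (ht : 0 ≤ t) (hs : 0 ≤ s) (hsum : α + β + t + s ≤ 1) (hlr : l + r ≤ t)
    (h1 : 0.9999 < α ^ (0.48 : ℝ) + r ^ (0.48 : ℝ)) (h2 : 0.9999 < l ^ (0.48 : ℝ) + β ^ (0.48 : ℝ)) :
    t ^ (0.48 : ℝ) + s ^ (0.48 : ℝ) ≤ 0.9999 := by
  have a1 := rpow_le_tangent (x₀ := 0.17792) (q := 0.436625) hα (by norm_num) (by norm_num) (by norm_num)
  have a2 := rpow_le_tangent (x₀ := 0.17792) (q := 0.436625) hβ (by norm_num) (by norm_num) (by norm_num)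
  have a3 := rpow_le_tangent (x₀ := 0.30246) (q := 0.563276) hl (by norm_num) (by norm_num) (by norm_num)
  have a4 := rpow_le_tangent (x₀ := 0.30246) (q := 0.563276) hr (by norm_num) (by norm_num) (by norm_num)
  have a5 := rpow_le_tangent (x₀ := 0.60492) (q := 0.785625) ht (by norm_num) (by norm_num) (by norm_num)
  have a6 := rpow_le_tangent (x₀ := 0.03924) (q := 0.211345) hs (by norm_num) (by norm_num) (by norm_num)
  by_contra! h3
  generalize α ^ (0.48 : ℝ) = α' at *
  generalize β ^ (0.48 : ℝ) = β' at *
  generalize l ^ (0.48 : ℝ) = l' at *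
  generalize r ^ (0.48 : ℝ) = r' at *
  generalize t ^ (0.48 : ℝ) = t' at *
  generalize s ^ (0.48 : ℝ) = s' at *
  norm_num at *
  linarith

/-- The same method for another triple of sums. The base points again maximize a positive
combination, now with ample slack. -/
theorem split_certificate_side {α β l r s : ℝ} (hα : 0 ≤ α) (hβ : 0 ≤ β) (hl : 0 ≤ l) (hr : 0 ≤ r)
    (hs : 0 ≤ s) (hsum : α + β + l + r + s ≤ 1)
    (h1 : 0.9999 < α ^ (0.48 : ℝ) + r ^ (0.48 : ℝ)) (h2 : 0.9999 < l ^ (0.48 : ℝ) + β ^ (0.48 : ℝ)) :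
    β ^ (0.48 : ℝ) + s ^ (0.48 : ℝ) ≤ 0.9999 := by
  have a1 := rpow_le_tangent (x₀ := 0.2125) (q := 0.475481) hα (by norm_num) (by norm_num) (by norm_num)
  have a2 := rpow_le_tangent (x₀ := 0.3765) (q := 0.625702) hβ (by norm_num) (by norm_num) (by norm_num)
  have a3 := rpow_le_tangent (x₀ := 0.0993) (q := 0.330017) hl (by norm_num) (by norm_num) (by norm_num)
  have a4 := rpow_le_tangent (x₀ := 0.2125) (q := 0.475481) hr (by norm_num) (by norm_num) (by norm_num)
  have a5 := rpow_le_tangent (x₀ := 0.0993) (q := 0.330017) hs (by norm_num) (by norm_num) (by norm_num)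
  by_contra! h3
  generalize α ^ (0.48 : ℝ) = α' at *
  generalize β ^ (0.48 : ℝ) = β' at *
  generalize l ^ (0.48 : ℝ) = l' at *
  generalize r ^ (0.48 : ℝ) = r' at *
  generalize s ^ (0.48 : ℝ) = s' at *
  norm_num at *
  linarith

/-- Subtree sizes `a` and `b` are small enough, jointly, for a path in a tree with `n` nodes. -/
def Fits (n a b : ℕ) : Prop :=
  (a : ℝ) ^ (0.48 : ℝ) + (b : ℝ) ^ (0.48 : ℝ) ≤ 0.9999 * (n : ℝ) ^ (0.48 : ℝ)

theorem Fits.symm {n a b : ℕ} (h : Fits n a b) : Fits n b a := by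
  unfold Fits at *; linarith

theorem Fits.mono {n a b a' b' : ℕ} (h : Fits n a b) (ha : a' ≤ a) (hb : b' ≤ b) :
    Fits n a' b' := by
  unfold Fits at *
  have h1 : (a' : ℝ) ^ (0.48 : ℝ) ≤ (a : ℝ) ^ (0.48 : ℝ) :=
    Real.rpow_le_rpow (by positivity) (by exact_mod_cast ha) (by norm_num)
  have h2 : (b' : ℝ) ^ (0.48 : ℝ) ≤ (b : ℝ) ^ (0.48 : ℝ) :=
    Real.rpow_le_rpow (by positivity) (by exact_mod_cast hb) (by norm_num)
  linarith

theorem fits_iff_div {n a b : ℕ} (hn : 0 < n) :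
    Fits n a b ↔ ((a : ℝ) / n) ^ (0.48 : ℝ) + ((b : ℝ) / n) ^ (0.48 : ℝ) ≤ 0.9999 := by
  have h : (0 : ℝ) < (n : ℝ) ^ (0.48 : ℝ) := by positivity
  rw [Real.div_rpow (by positivity) (by positivity), Real.div_rpow (by positivity) (by positivity),
    ← add_div, div_le_iff₀ h, Fits]

/-- `h1` and `h2` say that the search can prune neither the right part `r` nor the left part `l`.
The detour has left bound `max (max α β) t` and right bound `s`, and each of the three candidates
for the maximum is checked separately; for `α` the inequality `s ≤ β` suffices. -/
theorem fits_of_stuck {n α β l r t s : ℕ} (hn : 0 < n) (hsum : α + β + t + s ≤ n) (hlr : l + r ≤ t)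
    (hs : s ≤ β) (h : Fits n α β) (h1 : ¬ Fits n α r) (h2 : ¬ Fits n l β) :
    Fits n (max (max α β) t) s := by
  have hsum' : (α / n + β / n + t / n + s / n : ℝ) ≤ 1 := by
    rw [← add_div, ← add_div, ← add_div, div_le_one (by positivity)]; exact_mod_cast hsum
  have hlr' : (l / n + r / n : ℝ) ≤ t / n := by
    rw [← add_div]; gcongr; exact_mod_cast hlr
  rw [fits_iff_div hn, not_le] at h1 h2
  have key : Fits n α s ∧ Fits n β s ∧ Fits n t s := by
    refine ⟨h.mono le_rfl hs, ?_, ?_⟩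
    · rw [fits_iff_div hn]
      exact split_certificate_side (by positivity) (by positivity) (by positivity) (by positivity)
        (by positivity) (by linarith) h1 h2
    · rw [fits_iff_div hn]
      exact split_certificate_main (by positivity) (by positivity) (by positivity) (by positivity)
        (by positivity) (by positivity) hsum' hlr' h1 h2
  rcases max_choice (max α β) t with e | e <;> rw [e]
  · rcases max_choice α β with e | e <;> rw [e]
    exacts [key.1, key.2.1]
  · exact key.2.2

/-! ### The search for the path. -/

/-- Turning into the largest right subtree so far, of size `β`, yields a path whose right subtrees
are small: `t` bounds the remaining subtree that is then on the left, `s` the right subtrees seen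
before. Symmetrically for the largest left subtree, of size `α`. -/
def HasDetour (T : OrderedTree) (n α β m : ℕ) : Prop :=
  (∃ t s, m ≤ t ∧ s ≤ β ∧ α + β + t + s ≤ n ∧
    ∀ a b, α ≤ a → β ≤ a → t ≤ a → s ≤ b → SizeSpine a b T) ∨
  (∃ t s, m ≤ t ∧ s ≤ α ∧ α + β + t + s ≤ n ∧
    ∀ a b, s ≤ a → α ≤ b → β ≤ b → t ≤ b → SizeSpine a b T)

theorem HasDetour.mono {T : OrderedTree} {n α β m m' : ℕ} (h : HasDetour T n α β m) (hm : m' ≤ m) :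
    HasDetour T n α β m' := by
  rcases h with ⟨t, s, h, h'⟩ | ⟨t, s, h, h'⟩
  · exact .inl ⟨t, s, hm.trans h, h'⟩
  · exact .inr ⟨t, s, hm.trans h, h'⟩

/-- The path continues somewhere in the forest `cs`, which is all that is left of the tree; the
first hypothesis on `α` and `β` extends any good path of `cs` to one of `T`. For a forest `t :: ts`
the search either continues in `t`, charging the total size of `ts` to `β`, or drops `t` to the
left, charging its size to `α`. The detour always belongs to the latest increase of `α` or `β`. -/
theorem exists_sizeSpine_of_forest {T : OrderedTree} {n : ℕ} (hn : 0 < n) :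
    ∀ (m : ℕ) (cs : List OrderedTree), (cs.map size).sum ≤ m → cs ≠ [] → ∀ α β : ℕ,
      (∀ a b, α ≤ a → β ≤ b → ForestSpine a b cs → SizeSpine a b T) → Fits n α β →
      α + β + (cs.map size).sum ≤ n → HasDetour T n α β (cs.map size).sum →
      ∃ a b, Fits n a b ∧ SizeSpine a b T := by
  intro m
  induction m with
  | zero =>
    intro cs hm hne
    obtain ⟨t, ts, rfl⟩ := List.exists_cons_of_ne_nil hne
    have := t.size_pos
    simp at hm; omega
  | succ m ih =>
    intro cs hm hne α β hK hfit hsum hd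
    obtain ⟨t, ts, rfl⟩ := List.exists_cons_of_ne_nil hne
    have htpos := t.size_pos
    rcases eq_or_ne ts [] with rfl | hts
    · obtain ⟨cs⟩ := t
      simp only [List.map_cons, List.map_nil, List.sum_cons, List.sum_nil, size_node] at hm hsum hd
      rcases eq_or_ne cs [] with rfl | hcs
      · exact ⟨α, β, hfit, hK _ _ le_rfl le_rfl (forestSpine_head (by simp) .leaf)⟩
      · exact ih cs (by omega) hcs α β
          (fun a b ha hb h => hK a b ha hb (forestSpine_head (by simp) h.sizeSpine)) hfit (by omega)
          (hd.mono (by omega))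
    · have htspos : 0 < (ts.map size).sum := by
        obtain ⟨s, ss, rfl⟩ := List.exists_cons_of_ne_nil hts
        have := s.size_pos
        simp; omega
      simp only [List.map_cons, List.sum_cons] at hm hsum hd
      by_cases h1 : Fits n α (ts.map size).sum
      · have hstep : ∀ β', β ≤ β' → (ts.map size).sum ≤ β' → ∀ a b, α ≤ a → β' ≤ b →
            ForestSpine a b [t] → SizeSpine a b T := by
          intro β' hβ hβ' a b ha hb h
          refine hK a b ha (hβ.trans hb) ?_
          obtain ⟨_, t', r, e, -, -, h⟩ := h
          have : t' = t := by
            have := congrArg (t' ∈ ·) e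
            simpa using this
          exact forestSpine_head (hβ'.trans hb) (this ▸ h)
        rcases le_or_gt (ts.map size).sum β with hβ | hβ
        · exact ih [t] (by simp; omega) (by simp) α β (hstep β le_rfl hβ) hfit (by simp; omega)
            (hd.mono (by simp))
        -- A new record on the right: the detour enters `ts` and takes a rightmost path there. Then
        -- `t` and everything in `ts` can only be on the left, and the right subtrees are bounded by
        -- the old `β`.
        · refine ih [t] (by simp; omega) (by simp) α (ts.map size).sum (hstep _ hβ.le le_rfl) h1
            (by simp; omega) (.inl ⟨t.size, β, by simp, hβ.le, by omega, ?_⟩)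
          intro a b ha ha' hta hb
          exact hK a b ha hb (forestSpine_tail hta (forestSpine_rightmost b hts ha'))
      · by_cases h2 : Fits n t.size β
        · have hstep : ∀ α', α ≤ α' → t.size ≤ α' → ∀ a b, α' ≤ a → β ≤ b →
              ForestSpine a b ts → SizeSpine a b T := fun α' hα hα' a b ha hb h =>
            hK a b (hα.trans ha) hb (forestSpine_tail (hα'.trans ha) h)
          rcases le_or_gt t.size α with hα | hα
          · exact ih ts (by omega) hts α β (hstep α le_rfl hα) hfit (by omega) (hd.mono (by omega))
          -- A new record on the left: the detour follows the leftmost path of `t`, leaving `ts` on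
          -- the right.
          · refine ih ts (by omega) hts t.size β (hstep _ hα.le le_rfl) h2 (by omega)
              (.inr ⟨(ts.map size).sum, α, le_rfl, hα.le, by omega, ?_⟩)
            intro a b ha htb hb htsb
            exact hK a b ha hb (forestSpine_head htsb (sizeSpine_leftmost a b _ t le_rfl htb))
        -- Neither continuation fits, so the recorded detour is taken. The second case is the first
        -- with left and right exchanged.
        · rcases hd with ⟨u, s, hu, hs, hle, H⟩ | ⟨u, s, hu, hs, hle, H⟩
          · exact ⟨_, _, fits_of_stuck hn hle hu hs hfit h1 h2, H _ _ (by simp) (by simp) (by simp)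
              le_rfl⟩
          · refine ⟨s, max (max β α) u, (fits_of_stuck hn (l := (ts.map size).sum) (r := t.size)
              (by omega) (by omega) hs hfit.symm (fun h => h2 h.symm) (fun h => h1 h.symm)).symm,
              H _ _ le_rfl (by simp) (by simp) (by simp)⟩

/-- Chan's path lemma: some root-to-leaf path has left subtrees of size at most `a` and right subtrees
of size at most `b`, where `a ^ 0.48 + b ^ 0.48` is at most a constant fraction of `n ^ 0.48`. -/
theorem exists_sizeSpine (T : OrderedTree) : ∃ a b, Fits T.size a b ∧ SizeSpine a b T := by
  have h0 : Fits T.size 0 0 := by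
    unfold Fits
    have : (0 : ℝ) ≤ (T.size : ℝ) ^ (0.48 : ℝ) := by positivity
    norm_num at *
    linarith
  -- Nothing is pruned at the start, and the initial detour is the rightmost path of the whole tree.
  refine exists_sizeSpine_of_forest T.size_pos T.size [T] (by simp) (by simp) 0 0 ?_ h0 (by simp)
    (.inl ⟨T.size, 0, by simp, le_rfl, by simp, ?_⟩)
  · rintro a b - - ⟨l, t, r, e, -, -, h⟩
    have : t = T := by
      have := congrArg (t ∈ ·) e
      simpa using this
    exact this ▸ h
  · intro a b _ _ ha _
    exact sizeSpine_rightmost a b _ T le_rfl ha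

/-! ### Addresses of nodes. -/

theorem isNode_nil (T : OrderedTree) : T.IsNode [] := by
  cases T; rw [IsNode]; trivial

theorem isNode_cons {cs : List OrderedTree} {j : ℕ} {a : List ℕ} :
    (node cs).IsNode (j :: a) ↔ ∃ t, cs[j]? = some t ∧ t.IsNode a := by
  rw [IsNode]

theorem IsNode.of_append {T : OrderedTree} {a b : List ℕ} (h : T.IsNode (a ++ b)) : T.IsNode a := by
  induction a generalizing T with
  | nil => exact T.isNode_nil
  | cons j a ih =>
    cases T
    rw [List.cons_append, isNode_cons] at h
    obtain ⟨t, ht, h⟩ := h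
    exact isNode_cons.2 ⟨t, ht, ih h⟩

theorem IsNode.child_of_lt {T : OrderedTree} {i j : ℕ} (h : T.IsNode [j]) (hij : i < j) :
    T.IsNode [i] := by
  cases T with | node cs =>
  obtain ⟨t, ht, -⟩ := isNode_cons.1 h
  obtain ⟨hj, -⟩ := List.getElem?_eq_some_iff.1 ht
  exact isNode_cons.2 ⟨cs[i], List.getElem?_eq_getElem _, isNode_nil _⟩

/-! ### Segments and drawings as point sets -/

theorem exists_of_mem_openSegment {p q : ℤ × ℤ} {z : ℝ × ℝ}
    (h : z ∈ openSegment ℝ (toPlane p) (toPlane q)) :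
    ∃ s t : ℝ, 0 < s ∧ 0 < t ∧ s + t = 1 ∧ z.1 = s * p.1 + t * q.1 ∧ z.2 = s * p.2 + t * q.2 := by
  obtain ⟨s, t, hs, ht, hst, rfl⟩ := h
  exact ⟨s, t, hs, ht, hst, by simp [toPlane], by simp [toPlane]⟩

theorem combo_le {s t x y c : ℝ} (hs : 0 < s) (ht : 0 < t) (hst : s + t = 1) (hx : x ≤ c)
    (hy : y ≤ c) : s * x + t * y ≤ c := by
  calc s * x + t * y ≤ s * c + t * c := by gcongr
    _ = c := by rw [← add_mul, hst, one_mul]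

theorem le_combo {s t x y c : ℝ} (hs : 0 < s) (ht : 0 < t) (hst : s + t = 1) (hx : c ≤ x)
    (hy : c ≤ y) : c ≤ s * x + t * y := by
  calc c = s * c + t * c := by rw [← add_mul, hst, one_mul]
    _ ≤ s * x + t * y := by gcongr

/-- The points of the drawing of `T`: nodes and edges. -/
def Occ (T : OrderedTree) (P : Placement) : Set (ℝ × ℝ) :=
  {z | (∃ a, T.IsNode a ∧ z = toPlane (P a)) ∨ ∃ a i, T.IsNode (a ++ [i]) ∧ z ∈ openEdge P a i}

section Occ
variable {T : OrderedTree} {P : Placement} {z : ℝ × ℝ} {c : ℤ}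

theorem fst_le_of_mem_occ (hc : ∀ a, T.IsNode a → (P a).1 ≤ c) (hz : z ∈ Occ T P) : z.1 ≤ c := by
  rcases hz with ⟨a, ha, rfl⟩ | ⟨a, i, ha, hz⟩
  · exact Int.cast_le.2 (hc a ha)
  · obtain ⟨s, t, hs, ht, hst, h1, -⟩ := exists_of_mem_openSegment hz
    rw [h1]
    exact combo_le hs ht hst (Int.cast_le.2 (hc a ha.of_append)) (Int.cast_le.2 (hc _ ha))

theorem le_fst_of_mem_occ (hc : ∀ a, T.IsNode a → c ≤ (P a).1) (hz : z ∈ Occ T P) : c ≤ z.1 := by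
  rcases hz with ⟨a, ha, rfl⟩ | ⟨a, i, ha, hz⟩
  · exact Int.cast_le.2 (hc a ha)
  · obtain ⟨s, t, hs, ht, hst, h1, -⟩ := exists_of_mem_openSegment hz
    rw [h1]
    exact le_combo hs ht hst (Int.cast_le.2 (hc a ha.of_append)) (Int.cast_le.2 (hc _ ha))

theorem snd_le_of_mem_occ (hc : ∀ a, T.IsNode a → (P a).2 ≤ c) (hz : z ∈ Occ T P) : z.2 ≤ c := by
  rcases hz with ⟨a, ha, rfl⟩ | ⟨a, i, ha, hz⟩
  · exact Int.cast_le.2 (hc a ha)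
  · obtain ⟨s, t, hs, ht, hst, -, h1⟩ := exists_of_mem_openSegment hz
    rw [h1]
    exact combo_le hs ht hst (Int.cast_le.2 (hc a ha.of_append)) (Int.cast_le.2 (hc _ ha))

theorem le_snd_of_mem_occ (hc : ∀ a, T.IsNode a → c ≤ (P a).2) (hz : z ∈ Occ T P) : c ≤ z.2 := by
  rcases hz with ⟨a, ha, rfl⟩ | ⟨a, i, ha, hz⟩
  · exact Int.cast_le.2 (hc a ha)
  · obtain ⟨s, t, hs, ht, hst, -, h1⟩ := exists_of_mem_openSegment hz
    rw [h1]
    exact le_combo hs ht hst (Int.cast_le.2 (hc a ha.of_append)) (Int.cast_le.2 (hc _ ha))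

end Occ

/-- Every edge stays on one side of the column of a separating path that starts at the root. -/
theorem IsGLRPath.edge_side {T : OrderedTree} {P : Placement} {b : List ℕ}
    (h : T.IsGLRPath P [] b) {a : List ℕ} {i : ℕ} (ha : T.IsNode (a ++ [i])) :
    ((P a).1 ≤ (P []).1 ∧ (P (a ++ [i])).1 ≤ (P []).1) ∨
      ((P []).1 ≤ (P a).1 ∧ (P []).1 ≤ (P (a ++ [i])).1) := by
  have onpath : ∀ v : List ℕ, v <+: b → (P v).1 = (P []).1 := by
    intro v
    induction v using List.reverseRecOn with
    | nil => simp
    | append_singleton v k ih =>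
      intro hv
      rw [(h.vertical v k (List.nil_prefix) hv).1, ih ((List.prefix_append _ _).trans hv)]
  by_cases hab : a <+: b
  · rw [onpath a hab]
    rcases le_total (P (a ++ [i])).1 (P []).1 with h' | h'
    exacts [.inl ⟨le_rfl, h'⟩, .inr ⟨le_rfl, h'⟩]
  · -- the deepest path node above `a`
    obtain ⟨v, k, w, hav, hvb, hvk⟩ : ∃ v k w, a = v ++ k :: w ∧ v <+: b ∧ ¬ v ++ [k] <+: b := by
      clear ha
      induction a using List.reverseRecOn with
      | nil => exact absurd List.nil_prefix hab
      | append_singleton a k ih =>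
        by_cases h' : a <+: b
        · exact ⟨a, k, [], rfl, h', hab⟩
        · obtain ⟨v, j, w, rfl, h1, h2⟩ := ih h'
          exact ⟨v, j, w ++ [k], by simp, h1, h2⟩
    have hvk' : v ++ [k] <+: a := ⟨w, by simp [hav]⟩
    obtain ⟨r, hr⟩ := hvb
    cases r with
    | nil =>
      exfalso
      apply h.leaf.2 k
      rw [List.append_nil] at hr
      rw [← hr]
      have := ha.of_append
      rw [hav, List.append_cons] at this
      exact this.of_append
    | cons j r =>
      have hj : v ++ [j] <+: b := ⟨r, by simp [← hr]⟩
      have hjk : k ≠ j := fun e => hvk (e ▸ hj)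
      rcases lt_or_gt_of_ne hjk with hlt | hlt
      · exact .inl ⟨(h.left v j k a List.nil_prefix hj hlt hvk' ha.of_append).le,
          (h.left v j k _ List.nil_prefix hj hlt (hvk'.trans (List.prefix_append _ _)) ha).le⟩
      · exact .inr ⟨(h.right v j k a List.nil_prefix hj hlt hvk' ha.of_append).le,
          (h.right v j k _ List.nil_prefix hj hlt (hvk'.trans (List.prefix_append _ _)) ha).le⟩

/-- The assumption `hf` concerns nodes only. Edges obey the same bound because no edge crosses the
column of the separating path: an edge with an interior point in that column has both ends in it. -/
theorem snd_le_of_mem_occ_of_freeAboveRoot {T : OrderedTree} {P : Placement}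
    (h : T.IsGLRDrawing P) (hf : T.FreeAboveRoot P) {z : ℝ × ℝ} (hz : z ∈ Occ T P)
    (h1 : z.1 = (P []).1) : z.2 ≤ (P []).2 := by
  rcases hz with ⟨a, ha, rfl⟩ | ⟨a, i, ha, hz⟩
  · exact Int.cast_le.2 (hf a ha (Int.cast_injective h1))
  · obtain ⟨b, hb⟩ := h.path [] T.isNode_nil
    obtain ⟨s, t, hs, ht, hst, e1, e2⟩ := exists_of_mem_openSegment hz
    have hx : (P a).1 = (P []).1 ∧ (P (a ++ [i])).1 = (P []).1 := by
      have e : s * ((P a).1 - (P []).1 : ℝ) + t * ((P (a ++ [i])).1 - (P []).1 : ℝ) = 0 := by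
        rw [h1] at e1
        linear_combination (P []).1 * hst * (-1 : ℝ) - e1
      rcases hb.edge_side ha with ⟨g1, g2⟩ | ⟨g1, g2⟩
      · have g1' : ((P a).1 - (P []).1 : ℝ) ≤ 0 := sub_nonpos.2 (Int.cast_le.2 g1)
        have g2' : ((P (a ++ [i])).1 - (P []).1 : ℝ) ≤ 0 := sub_nonpos.2 (Int.cast_le.2 g2)
        have k1 := mul_nonpos_of_nonneg_of_nonpos hs.le g1'
        have k2 := mul_nonpos_of_nonneg_of_nonpos ht.le g2'
        have m1 : s * ((P a).1 - (P []).1 : ℝ) = 0 := by linarith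
        have m2 : t * ((P (a ++ [i])).1 - (P []).1 : ℝ) = 0 := by linarith
        exact ⟨Int.cast_injective (α := ℝ)
            (sub_eq_zero.1 ((mul_eq_zero.1 m1).resolve_left hs.ne')),
          Int.cast_injective (α := ℝ) (sub_eq_zero.1 ((mul_eq_zero.1 m2).resolve_left ht.ne'))⟩
      · have g1' : (0 : ℝ) ≤ ((P a).1 - (P []).1 : ℝ) := sub_nonneg.2 (Int.cast_le.2 g1)
        have g2' : (0 : ℝ) ≤ ((P (a ++ [i])).1 - (P []).1 : ℝ) := sub_nonneg.2 (Int.cast_le.2 g2)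
        have k1 := mul_nonneg hs.le g1'
        have k2 := mul_nonneg ht.le g2'
        have m1 : s * ((P a).1 - (P []).1 : ℝ) = 0 := by linarith
        have m2 : t * ((P (a ++ [i])).1 - (P []).1 : ℝ) = 0 := by linarith
        exact ⟨Int.cast_injective (α := ℝ)
            (sub_eq_zero.1 ((mul_eq_zero.1 m1).resolve_left hs.ne')),
          Int.cast_injective (α := ℝ) (sub_eq_zero.1 ((mul_eq_zero.1 m2).resolve_left ht.ne'))⟩
    rw [e2]
    exact combo_le hs ht hst (Int.cast_le.2 (hf a ha.of_append hx.1)) (Int.cast_le.2 (hf _ ha hx.2))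

/-! ### Putting a root on top of drawings of its subtrees -/

/-- The root is placed at `o`, and the subtree at the `j`-th child is drawn by `sub j`. -/
def place (o : ℤ × ℤ) (sub : ℕ → Placement) : Placement
  | [] => o
  | j :: a => sub j a

/-- Only the edges at the root are new. Two of them cannot meet because `hcross` makes their
directions non-parallel. The case `j = k` of `hstar` keeps such an edge off the drawing of its own
subtree. -/
theorem isPlanar_place {cs : List OrderedTree} {o : ℤ × ℤ} {sub : ℕ → Placement}
    (hsub : ∀ (j : ℕ) (t : OrderedTree), cs[j]? = some t → t.IsPlanar (sub j))
    (hdisj : ∀ j t k u, cs[j]? = some t → cs[k]? = some u → j ≠ k →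
      Disjoint (Occ t (sub j)) (Occ u (sub k)))
    (hroot : ∀ j t, cs[j]? = some t → toPlane o ∉ Occ t (sub j))
    (hstar : ∀ j k t u, cs[j]? = some t → cs[k]? = some u →
      Disjoint (openSegment ℝ (toPlane o) (toPlane (sub j []))) (Occ u (sub k)))
    (hcross : ∀ j k t u, cs[j]? = some t → cs[k]? = some u → j < k →
      0 < cross (sub j [] - o) (sub k [] - o)) :
    (node cs).IsPlanar (place o sub) := by
  have node_occ : ∀ {j t a}, t.IsNode a → toPlane (sub j a) ∈ Occ t (sub j) :=
    fun ha => .inl ⟨_, ha, rfl⟩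
  have edge_occ : ∀ {j t a i z}, t.IsNode (a ++ [i]) → z ∈ openEdge (sub j) a i →
      z ∈ Occ t (sub j) := fun ha hz => .inr ⟨_, _, ha, hz⟩
  have hstar2 : ∀ j k t u, cs[j]? = some t → cs[k]? = some u → j < k →
      Disjoint (openSegment ℝ (toPlane o) (toPlane (sub j [])))
        (openSegment ℝ (toPlane o) (toPlane (sub k []))) := by
    intro j k t u hj hk hjk
    rw [Set.disjoint_left]
    intro z hz hz'
    have hc := hcross j k t u hj hk hjk
    obtain ⟨s, r, hs, hr, hsr, e1, e2⟩ := exists_of_mem_openSegment hz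
    obtain ⟨s', r', hs', hr', hsr', e1', e2'⟩ := exists_of_mem_openSegment hz'
    have hc' : (0 : ℝ) < ((sub j []).1 - o.1) * ((sub k []).2 - o.2) -
        ((sub j []).2 - o.2) * ((sub k []).1 - o.1) := by
      have := Int.cast_pos (R := ℝ).2 hc
      simpa [cross] using this
    obtain rfl : s = 1 - r := by linarith
    obtain rfl : s' = 1 - r' := by linarith
    have f1 : r * ((sub j []).1 - o.1 : ℝ) = r' * ((sub k []).1 - o.1) := by linarith
    have f2 : r * ((sub j []).2 - o.2 : ℝ) = r' * ((sub k []).2 - o.2) := by linarith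
    have : r * (((sub j []).1 - o.1) * ((sub k []).2 - o.2) -
        ((sub j []).2 - o.2) * ((sub k []).1 - o.1) : ℝ) = 0 := by
      linear_combination ((sub k []).2 - o.2 : ℝ) * f1 - ((sub k []).1 - o.1 : ℝ) * f2
    have := mul_pos hr hc'
    linarith
  refine ⟨?_, ?_, ?_⟩
  · rintro (_ | ⟨j, a⟩) (_ | ⟨k, b⟩) ha hb e
    · rfl
    · obtain ⟨t, ht, hb⟩ := isNode_cons.1 hb
      exact absurd (.inl ⟨b, hb, congrArg toPlane e⟩) (hroot k t ht)
    · obtain ⟨t, ht, ha⟩ := isNode_cons.1 ha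
      exact absurd (.inl ⟨a, ha, congrArg toPlane e.symm⟩) (hroot j t ht)
    · obtain ⟨t, ht, ha⟩ := isNode_cons.1 ha
      obtain ⟨u, hu, hb⟩ := isNode_cons.1 hb
      have e' : sub j a = sub k b := e
      rcases eq_or_ne j k with rfl | hjk
      · obtain rfl : t = u := Option.some_injective _ (ht.symm.trans hu)
        rw [(hsub j t ht).inj a b ha hb e']
      · exact absurd (e' ▸ node_occ ha)
          (Set.disjoint_right.1 (hdisj j t k u ht hu hjk) (node_occ hb))
  · rintro (_ | ⟨j, a⟩) (_ | ⟨k, b⟩) i ha hb hz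
    · obtain ⟨t, ht, -⟩ := isNode_cons.1 hb
      have hz' : toPlane o ∈ openSegment ℝ (toPlane o) (toPlane (sub i [])) := hz
      rw [left_mem_openSegment_iff] at hz'
      exact hroot i t ht (hz' ▸ node_occ t.isNode_nil)
    · obtain ⟨t, ht, hb⟩ := isNode_cons.1 hb
      exact hroot k t ht (edge_occ hb hz)
    · obtain ⟨t, ht, ha⟩ := isNode_cons.1 ha
      obtain ⟨u, hu, -⟩ := isNode_cons.1 hb
      exact Set.disjoint_left.1 (hstar i j u t hu ht) hz (node_occ ha)
    · obtain ⟨t, ht, ha⟩ := isNode_cons.1 ha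
      obtain ⟨u, hu, hb⟩ := isNode_cons.1 hb
      rcases eq_or_ne j k with rfl | hjk
      · obtain rfl : t = u := Option.some_injective _ (ht.symm.trans hu)
        exact (hsub j t ht).node_edge a b i ha hb hz
      · exact Set.disjoint_left.1 (hdisj j t k u ht hu hjk) (node_occ ha) (edge_occ hb hz)
  · rintro (_ | ⟨j, a⟩) i (_ | ⟨k, b⟩) i' ha hb hne
    · obtain ⟨t, ht, -⟩ := isNode_cons.1 ha
      obtain ⟨u, hu, -⟩ := isNode_cons.1 hb
      have hne' : i ≠ i' := fun e => hne (by rw [e])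
      rcases lt_or_gt_of_ne hne' with h | h
      · exact hstar2 i i' t u ht hu h
      · exact (hstar2 i' i u t hu ht h).symm
    · obtain ⟨t, ht, -⟩ := isNode_cons.1 ha
      obtain ⟨u, hu, hb⟩ := isNode_cons.1 hb
      exact (hstar i k t u ht hu).mono_right fun z hz => edge_occ hb hz
    · obtain ⟨t, ht, ha⟩ := isNode_cons.1 ha
      obtain ⟨u, hu, -⟩ := isNode_cons.1 hb
      exact ((hstar i' j u t hu ht).mono_right fun z hz => edge_occ ha hz).symm
    · obtain ⟨t, ht, ha⟩ := isNode_cons.1 ha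
      obtain ⟨u, hu, hb⟩ := isNode_cons.1 hb
      rcases eq_or_ne j k with rfl | hjk
      · obtain rfl : t = u := Option.some_injective _ (ht.symm.trans hu)
        exact (hsub j t ht).edge_edge a i b i' ha hb fun e => hne (by
          simp only [Prod.mk.injEq] at e; rw [e.1, e.2])
      · exact (hdisj j t k u ht hu hjk).mono (fun z hz => edge_occ ha hz)
          (fun z hz => edge_occ hb hz)

theorem isOrderPreserving_place {cs : List OrderedTree} {o : ℤ × ℤ} {sub : ℕ → Placement}
    (hsub : ∀ (j : ℕ) (t : OrderedTree), cs[j]? = some t → t.IsOrderPreserving (sub j))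
    (hcross : ∀ j k t u, cs[j]? = some t → cs[k]? = some u → j < k →
      0 < cross (sub j [] - o) (sub k [] - o))
    (hparent : ∀ h t i j, cs[h]? = some t → i < j → t.IsNode [j] →
      CCW (o - sub h []) (dir (sub h) [] [i]) (dir (sub h) [] [j])) :
    (node cs).IsOrderPreserving (place o sub) := by
  refine ⟨?_, ?_⟩
  · rintro (_ | ⟨h, a⟩) i j k hij hjk hk
    · have hk' : (node cs).IsNode [k] := hk
      have hj' := hk'.child_of_lt hjk
      have hi' := hj'.child_of_lt hij
      obtain ⟨t, ht, -⟩ := isNode_cons.1 hi'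
      obtain ⟨u, hu, -⟩ := isNode_cons.1 hj'
      obtain ⟨v, hv, -⟩ := isNode_cons.1 hk'
      exact .inl ⟨hcross i j t u ht hu hij, hcross j k u v hu hv hjk⟩
    · obtain ⟨t, ht, hk⟩ := isNode_cons.1 hk
      exact (hsub h t ht).children a i j k hij hjk hk
  · rintro (_ | ⟨k, a⟩) h i j hij hj
    · obtain ⟨t, ht, hj⟩ := isNode_cons.1 hj
      exact hparent h t i j ht hij hj
    · obtain ⟨t, ht, hj⟩ := isNode_cons.1 hj
      exact (hsub k t ht).parent a h i j hij hj

theorem isGLRPath_place_cons {cs : List OrderedTree} {o : ℤ × ℤ} {sub : ℕ → Placement} {k : ℕ}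
    {t : OrderedTree} {a b : List ℕ} (ht : cs[k]? = some t) (h : t.IsGLRPath (sub k) a b) :
    (node cs).IsGLRPath (place o sub) (k :: a) (k :: b) := by
  have key : ∀ {v i}, k :: a <+: v → v ++ [i] <+: k :: b →
      ∃ v', v = k :: v' ∧ a <+: v' ∧ v' ++ [i] <+: b := by
    rintro (_ | ⟨m, v⟩) i hv hb
    · simp at hv
    · rw [List.cons_append, List.cons_prefix_cons] at hb
      rw [List.cons_prefix_cons] at hv
      exact ⟨v, by rw [hb.1], hv.2, hb.2⟩
  refine ⟨⟨isNode_cons.2 ⟨t, ht, h.leaf.1⟩, ?_⟩, ?_, ?_, ?_, ?_⟩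
  · rintro i hi
    obtain ⟨u, hu, hi⟩ := isNode_cons.1 hi
    obtain rfl : t = u := Option.some_injective _ (ht.symm.trans hu)
    exact h.leaf.2 i hi
  · exact List.cons_prefix_cons.2 ⟨rfl, h.down⟩
  · intro v i hv hb
    obtain ⟨v, rfl, hv, hb⟩ := key hv hb
    exact h.vertical v i hv hb
  · intro v i j w hv hb hij hw hwn
    obtain ⟨v, rfl, hv, hb⟩ := key hv hb
    cases w with
    | nil => simp at hw
    | cons m w =>
      rw [List.cons_append, List.cons_prefix_cons] at hw
      obtain ⟨rfl, hw⟩ := hw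
      obtain ⟨u, hu, hwn⟩ := isNode_cons.1 hwn
      obtain rfl : t = u := Option.some_injective _ (ht.symm.trans hu)
      exact h.left v i j w hv hb hij hw hwn
  · intro v i j w hv hb hij hw hwn
    obtain ⟨v, rfl, hv, hb⟩ := key hv hb
    cases w with
    | nil => simp at hw
    | cons m w =>
      rw [List.cons_append, List.cons_prefix_cons] at hw
      obtain ⟨rfl, hw⟩ := hw
      obtain ⟨u, hu, hwn⟩ := isNode_cons.1 hwn
      obtain rfl : t = u := Option.some_injective _ (ht.symm.trans hu)
      exact h.right v i j w hv hb hij hw hwn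

theorem isGLRPath_place_nil {cs : List OrderedTree} {o : ℤ × ℤ} {sub : ℕ → Placement} {p : ℕ}
    {t : OrderedTree} {b : List ℕ} (ht : cs[p]? = some t) (h : t.IsGLRPath (sub p) [] b)
    (hcol : (sub p []).1 = o.1) (hrow : (sub p []).2 < o.2)
    (hl : ∀ j u a, j < p → cs[j]? = some u → u.IsNode a → (sub j a).1 < o.1)
    (hr : ∀ j u a, p < j → cs[j]? = some u → u.IsNode a → o.1 < (sub j a).1) :
    (node cs).IsGLRPath (place o sub) [] (p :: b) := by
  have h' := isGLRPath_place_cons (o := o) ht h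
  have hcol' : (place o sub [p]).1 = o.1 := hcol
  refine ⟨h'.leaf, List.nil_prefix, ?_, ?_, ?_⟩
  · rintro (_ | ⟨m, v⟩) i - hb
    · rw [List.nil_append, List.cons_prefix_cons] at hb
      obtain ⟨rfl, -⟩ := hb
      exact ⟨hcol, hrow⟩
    · refine h'.vertical _ i ?_ hb
      rw [List.cons_append, List.cons_prefix_cons] at hb
      rw [hb.1]; simp
  · rintro (_ | ⟨m, v⟩) i j w - hb hij hw hwn
    · rw [List.nil_append, List.cons_prefix_cons] at hb
      obtain ⟨rfl, -⟩ := hb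
      obtain ⟨w, rfl⟩ := hw
      obtain ⟨u, hu, hwn⟩ := isNode_cons.1 hwn
      exact hl j u w hij hu hwn
    · have hm : m = p := by
        rw [List.cons_append, List.cons_prefix_cons] at hb
        exact hb.1
      exact (h'.left _ i j w (by rw [hm]; simp) hb hij hw hwn).trans_eq hcol'
  · rintro (_ | ⟨m, v⟩) i j w - hb hij hw hwn
    · rw [List.nil_append, List.cons_prefix_cons] at hb
      obtain ⟨rfl, -⟩ := hb
      obtain ⟨w, rfl⟩ := hw
      obtain ⟨u, hu, hwn⟩ := isNode_cons.1 hwn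
      exact hr j u w hij hu hwn
    · have hm : m = p := by
        rw [List.cons_append, List.cons_prefix_cons] at hb
        exact hb.1
      exact hcol'.symm.trans_lt (h'.right _ i j w (by rw [hm]; simp) hb hij hw hwn)

/-! ### Translations -/

/-- The drawing translated by `v`. -/
def shift (P : Placement) (v : ℤ × ℤ) : Placement := fun a => v + P a

theorem toPlane_add (p q : ℤ × ℤ) : toPlane (p + q) = toPlane p + toPlane q := by
  simp [toPlane]

theorem openEdge_shift (P : Placement) (v : ℤ × ℤ) (a : List ℕ) (i : ℕ) :
    openEdge (shift P v) a i = (fun z => toPlane v + z) '' openEdge P a i := by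
  simp only [openEdge, shift, toPlane_add, openSegment_translate_image]

theorem dir_shift (P : Placement) (v : ℤ × ℤ) (a b : List ℕ) : dir (shift P v) a b = dir P a b := by
  simp [dir, shift]

theorem IsGLRDrawing.shift {T : OrderedTree} {P : Placement} (h : T.IsGLRDrawing P) (v : ℤ × ℤ) :
    T.IsGLRDrawing (shift P v) := by
  have hinj : Function.Injective fun z : ℝ × ℝ => toPlane v + z := add_right_injective _
  refine ⟨⟨?_, ?_, ?_⟩, ⟨?_, ?_⟩, ?_⟩
  · intro a b ha hb e
    exact h.planar.inj a b ha hb (add_left_cancel e)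
  · intro a b i ha hb hz
    rw [openEdge_shift, OrderedTree.shift, toPlane_add] at hz
    obtain ⟨z, hz, e⟩ := hz
    exact h.planar.node_edge a b i ha hb (hinj e ▸ hz)
  · intro a i b j ha hb hne
    rw [openEdge_shift, openEdge_shift]
    exact (Set.disjoint_image_iff hinj).2 (h.planar.edge_edge a i b j ha hb hne)
  · simpa only [dir_shift] using h.ordered.children
  · simpa only [dir_shift] using h.ordered.parent
  · intro a ha
    obtain ⟨b, hb⟩ := h.path a ha
    refine ⟨b, hb.leaf, hb.down, ?_, ?_, ?_⟩
    · simpa [OrderedTree.shift] using hb.vertical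
    · simpa [OrderedTree.shift] using hb.left
    · simpa [OrderedTree.shift] using hb.right

/-! ### Stacking blocks of rows -/

/-- The total size of the blocks of lower rank. -/
def offset (S : Finset ℕ) (ρ : ℕ → ℤ) (sz : ℕ → ℕ) (j : ℕ) : ℕ := ∑ i ∈ S with ρ i < ρ j, sz i

section Offset
variable {S : Finset ℕ} {ρ : ℕ → ℤ} {sz : ℕ → ℕ} {i j : ℕ}

theorem offset_add_le_offset (hi : i ∈ S) (h : ρ i < ρ j) :
    offset S ρ sz i + sz i ≤ offset S ρ sz j := by
  rw [offset, ← Finset.sum_singleton sz i, ← Finset.sum_union (by simp)]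
  refine Finset.sum_le_sum_of_subset fun x hx => ?_
  simp only [Finset.mem_union, Finset.mem_filter, Finset.mem_singleton] at hx ⊢
  rcases hx with ⟨hx, hx'⟩ | rfl
  · exact ⟨hx, hx'.trans h⟩
  · exact ⟨hi, h⟩

theorem offset_add_le_sum (hi : i ∈ S) : offset S ρ sz i + sz i ≤ ∑ j ∈ S, sz j := by
  rw [offset, ← Finset.sum_singleton sz i, ← Finset.sum_union (by simp)]
  refine Finset.sum_le_sum_of_subset fun x hx => ?_
  simp only [Finset.mem_union, Finset.mem_filter, Finset.mem_singleton] at hx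
  rcases hx with ⟨hx, -⟩ | rfl
  exacts [hx, hi]

theorem offset_eq_zero (h : ∀ j ∈ S, ρ i ≤ ρ j) : offset S ρ sz i = 0 := by
  rw [offset, Finset.filter_false_of_mem (fun j hj => not_lt.2 (h j hj)), Finset.sum_empty]

theorem offset_eq_offset_add (hi : i ∈ S) (hij : ρ i < ρ j)
    (h : ∀ x ∈ S, x ≠ i → ρ x < ρ j → ρ x < ρ i) :
    offset S ρ sz j = offset S ρ sz i + sz i := by
  refine le_antisymm ?_ (offset_add_le_offset hi hij)
  rw [offset, offset, ← Finset.sum_singleton sz i, ← Finset.sum_union (by simp)]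
  refine Finset.sum_le_sum_of_subset fun x hx => ?_
  simp only [Finset.mem_union, Finset.mem_filter, Finset.mem_singleton] at hx ⊢
  rcases eq_or_ne x i with rfl | hne
  · exact .inr rfl
  · exact .inl ⟨hx.1, h x hx.1 hne hx.2⟩

theorem offset_add_eq_sum (hi : i ∈ S) (h : ∀ x ∈ S, x ≠ i → ρ x < ρ i) :
    offset S ρ sz i + sz i = ∑ j ∈ S, sz j := by
  refine le_antisymm (offset_add_le_sum hi) ?_
  rw [offset, ← Finset.sum_singleton sz i, ← Finset.sum_union (by simp)]
  refine Finset.sum_le_sum_of_subset fun x hx => ?_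
  simp only [Finset.mem_union, Finset.mem_filter, Finset.mem_singleton]
  rcases eq_or_ne x i with rfl | hne
  · exact .inr rfl
  · exact .inl ⟨hx, h x hx hne⟩

end Offset

/-! ### Normalized drawings -/

/-- GLR-drawings with rows `0, …, n - 1`, columns from `-A` to `B`, the root in column `0` with no
node above it. For children `i < j` of the root, the counterclockwise angle from the edge to `i` to
the edge to `j` is less than `π`. -/
structure IsLayout (T : OrderedTree) (P : Placement) (A B : ℕ) : Prop where
  glr : T.IsGLRDrawing P
  root : (P []).1 = 0
  free : T.FreeAboveRoot P
  fst_ge : ∀ a, T.IsNode a → -(A : ℤ) ≤ (P a).1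
  fst_le : ∀ a, T.IsNode a → (P a).1 ≤ B
  snd_nonneg : ∀ a, T.IsNode a → 0 ≤ (P a).2
  snd_lt : ∀ a, T.IsNode a → (P a).2 < T.size
  bot : ∃ a, T.IsNode a ∧ (P a).2 = 0
  top : ∃ a, T.IsNode a ∧ (P a).2 = T.size - 1
  cross_pos : ∀ i j, i < j → T.IsNode [j] → 0 < cross (dir P [] [i]) (dir P [] [j])

/-- Coordinates of the linear relation between three plane vectors. They serve to determine the sign
of one cross product from those of the others. -/
theorem cross_identity_fst (u v w : ℤ × ℤ) :
    u.1 * cross v w + v.1 * cross w u + w.1 * cross u v = 0 := by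
  simp only [cross]; ring

theorem cross_identity_snd (u v w : ℤ × ℤ) :
    u.2 * cross v w + v.2 * cross w u + w.2 * cross u v = 0 := by
  simp only [cross]; ring

theorem ccw_of_cross_pos {u v w : ℤ × ℤ} (h : 0 < cross v w) (h' : 0 < cross w u ∨ 0 < cross u v) :
    CCW u v w := by
  rcases h' with h' | h'
  · exact .inr (.inl ⟨h, h'⟩)
  · exact .inl ⟨h', h⟩

section IsLayout
variable {T : OrderedTree} {P : Placement} {A B : ℕ} {u : ℤ × ℤ} {i j : ℕ}

/-- This and the next three lemmas locate the edge to the parent, of direction `u`, among the edges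
to the children. Here the parent is strictly above the root and no child is; in the next two, the
parent and the children are separated by the column of the root. If neither remaining cross product
were positive, the linear relation would have a nonzero sum. -/
theorem IsLayout.ccw_of_typeI (h : T.IsLayout P A B) (hI : T.IsTypeI P) (hu : 0 < u.2) (hij : i < j)
    (hj : T.IsNode [j]) : CCW u (dir P [] [i]) (dir P [] [j]) := by
  have hc := h.cross_pos i j hij hj
  have hneg : ∀ k, T.IsNode [k] → (dir P [] [k]).2 ≤ 0 := fun k hk => by
    have := hI [k] hk
    simp only [dir, Prod.snd_sub]; omega
  refine ccw_of_cross_pos hc ?_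
  by_contra! hcon
  have := cross_identity_snd u (dir P [] [i]) (dir P [] [j])
  have h1 := mul_pos hu hc
  have h2 := mul_nonneg_of_nonpos_of_nonpos (hneg i (hj.child_of_lt hij)) hcon.1
  have h3 := mul_nonneg_of_nonpos_of_nonpos (hneg j hj) hcon.2
  linarith

theorem IsLayout.ccw_of_right (h : T.IsLayout P 0 B) (hu : u.1 < 0) (hij : i < j)
    (hj : T.IsNode [j]) : CCW u (dir P [] [i]) (dir P [] [j]) := by
  have hc := h.cross_pos i j hij hj
  have hpos : ∀ k, T.IsNode [k] → 0 ≤ (dir P [] [k]).1 := fun k hk => by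
    have := h.fst_ge [k] hk
    have := h.root
    simp only [dir, Prod.fst_sub]; omega
  refine ccw_of_cross_pos hc ?_
  by_contra! hcon
  have := cross_identity_fst u (dir P [] [i]) (dir P [] [j])
  have h1 := mul_neg_of_neg_of_pos hu hc
  have h2 := mul_nonpos_of_nonneg_of_nonpos (hpos i (hj.child_of_lt hij)) hcon.1
  have h3 := mul_nonpos_of_nonneg_of_nonpos (hpos j hj) hcon.2
  linarith

theorem IsLayout.ccw_of_left (h : T.IsLayout P A 0) (hu : 0 < u.1) (hij : i < j)
    (hj : T.IsNode [j]) : CCW u (dir P [] [i]) (dir P [] [j]) := by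
  have hc := h.cross_pos i j hij hj
  have hneg : ∀ k, T.IsNode [k] → (dir P [] [k]).1 ≤ 0 := fun k hk => by
    have := h.fst_le [k] hk
    have := h.root
    simp only [dir, Prod.fst_sub]; omega
  refine ccw_of_cross_pos hc ?_
  by_contra! hcon
  have := cross_identity_fst u (dir P [] [i]) (dir P [] [j])
  have h1 := mul_pos hu hc
  have h2 := mul_nonneg_of_nonpos_of_nonpos (hneg i (hj.child_of_lt hij)) hcon.1
  have h3 := mul_nonneg_of_nonpos_of_nonpos (hneg j hj) hcon.2
  linarith

/-- With the parent straight above, children may lie on both sides and higher than the root. The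
separating path helps: child `i` is strictly left of its column or child `j` strictly right of it.
-/
theorem IsLayout.ccw_of_up (h : T.IsLayout P A B) (hu : u.1 = 0) (hu' : 0 < u.2) (hij : i < j)
    (hj : T.IsNode [j]) : CCW u (dir P [] [i]) (dir P [] [j]) := by
  refine ccw_of_cross_pos (h.cross_pos i j hij hj) ?_
  obtain ⟨b, hb⟩ := h.glr.path [] T.isNode_nil
  have hi := hj.child_of_lt hij
  cases b with
  | nil => exact absurd hi (hb.leaf.2 i)
  | cons p b =>
    have hp : [] ++ [p] <+: p :: b := by simp
    rcases lt_or_ge i p with hip | hip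
    · have := hb.left [] p i [i] List.nil_prefix hp hip (by simp) hi
      right
      simp only [cross, dir, hu, Prod.fst_sub]
      nlinarith
    · have := hb.right [] p j [j] List.nil_prefix hp (hip.trans_lt hij) (by simp) hj
      left
      simp only [cross, dir, hu, Prod.fst_sub]
      nlinarith

theorem IsLayout.width_le (h : T.IsLayout P A B) : T.width P ≤ A + B + 1 := by
  have hsub : {x : ℤ | ∃ a b, T.IsNode a ∧ T.IsNode b ∧ (P a).1 ≤ x ∧ x ≤ (P b).1} ⊆
      ↑(Finset.Icc (-(A : ℤ)) B) := by
    rintro x ⟨a, b, ha, hb, h1, h2⟩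
    simp only [Finset.coe_Icc, Set.mem_Icc]
    exact ⟨(h.fst_ge a ha).trans h1, h2.trans (h.fst_le b hb)⟩
  refine (Set.ncard_le_ncard hsub (Finset.finite_toSet _)).trans ?_
  rw [Set.ncard_coe_finset, Int.card_Icc]
  omega

theorem IsLayout.height_eq (h : T.IsLayout P A B) : T.height P = T.size := by
  have : {y : ℤ | ∃ a b, T.IsNode a ∧ T.IsNode b ∧ (P a).2 ≤ y ∧ y ≤ (P b).2} =
      ↑(Finset.Ico (0 : ℤ) T.size) := by
    ext y
    simp only [Finset.coe_Ico, Set.mem_Ico, Set.mem_ofPred_eq]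
    constructor
    · rintro ⟨a, b, ha, hb, h1, h2⟩
      exact ⟨(h.snd_nonneg a ha).trans h1, h2.trans_lt (h.snd_lt b hb)⟩
    · rintro ⟨h1, h2⟩
      obtain ⟨a, ha, ea⟩ := h.bot
      obtain ⟨b, hb, eb⟩ := h.top
      exact ⟨a, b, ha, hb, by omega, by omega⟩
  rw [height, this, Set.ncard_coe_finset, Int.card_Ico]
  simp

end IsLayout

theorem isLayout_leaf : (node []).IsLayout (fun _ => 0) 0 0 ∧ (node []).IsTypeI (fun _ => 0) := by
  have hnode : ∀ a, (node []).IsNode a ↔ a = [] := by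
    rintro (_ | ⟨j, a⟩)
    · simp [isNode_nil]
    · simp [isNode_cons]
  have hs : (node []).size = 1 := by simp [size_node]
  refine ⟨⟨⟨⟨?_, ?_, ?_⟩, ⟨?_, ?_⟩, ?_⟩, rfl, ?_, ?_, ?_, ?_, ?_, ?_, ?_, ?_⟩, ?_⟩
  all_goals simp [hnode, FreeAboveRoot, IsTypeI, hs]
  refine ⟨[], ⟨by simp [IsLeaf, hnode], List.prefix_rfl, ?_, ?_, ?_⟩⟩ <;> simp

/-! ### Stacking the subtrees and the root in disjoint blocks of rows. -/

/-- The number of rows of the `j`-th subtree, and `1` (for the root) if there is no such subtree. -/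
def blockSize (cs : List OrderedTree) (j : ℕ) : ℕ := (cs[j]?.map size).getD 1

theorem sum_blockSize (cs : List OrderedTree) :
    ∑ j ∈ Finset.range (cs.length + 1), blockSize cs j = (node cs).size := by
  have h : ∑ j ∈ Finset.range cs.length, blockSize cs j = (cs.map size).sum := by
    induction cs with
    | nil => simp
    | cons c cs ih =>
      rw [List.length_cons, Finset.sum_range_succ', List.map_cons, List.sum_cons, ← ih, add_comm]
      simp [blockSize]
  rw [Finset.sum_range_succ, h, size_node, add_comm]
  simp [blockSize]

/-- Two edges on the same side of the root, with horizontal extents `d`, `e` and vertical offsets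
`a`, `b`. A long edge must end one row below the root, and `a ≠ 0` because no other block shares the
row of the root. -/
theorem cross_pos_of_same_side {d e a b : ℤ} (hd : 1 ≤ d) (he : 1 ≤ e) (hd' : d = 1 ∨ a = -1)
    (he' : e = 1 ∨ b = -1) (ha : a ≠ 0) (hab : b < a) : 0 < a * e - d * b := by
  rcases hd' with rfl | rfl <;> rcases he' with rfl | rfl
  · linarith
  · have : 1 ≤ a := by omega
    nlinarith
  · have : b ≤ -2 := by omega
    nlinarith
  · omega

/-- The data for drawing a tree with root subtrees `cs`: drawings `P j` of the subtrees, shifted by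
`dx j` columns and stacked in the order given by the rank `ρ`, where `ρ cs.length` is the rank of
the root. The path continues in the `p`-th subtree. -/
structure Stacking (cs : List OrderedTree) (p : ℕ) (P : ℕ → Placement) (A B : ℕ → ℕ) (ρ dx : ℕ → ℤ) :
    Prop where
  lt : p < cs.length
  layout : ∀ (j : ℕ) (t : OrderedTree), cs[j]? = some t → t.IsLayout (P j) (A j) (B j)
  rank_inj : ∀ i j, i ≤ cs.length → j ≤ cs.length → ρ i = ρ j → i = j
  rank_path : ∀ j, j ≤ cs.length → j ≠ p → ρ p < ρ j
  path : dx p = 0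
  left : ∀ j, j < p → dx j + B j ≤ -1
  right : ∀ j, p < j → j < cs.length → 1 ≤ dx j - A j
  attach : ∀ (j : ℕ) (t : OrderedTree), cs[j]? = some t → j ≠ p → (dx j = -1 ∧ B j = 0) ∨ (dx j = 1 ∧ A j = 0) ∨
    (t.IsTypeI (P j) ∧ ρ j < ρ cs.length ∧ ∀ i, i < cs.length → i ≠ j → ρ i < ρ cs.length → ρ i < ρ j)
  left_left : ∀ i j, i < j → j < p → ρ j < ρ i
  right_right : ∀ i j, p < i → i < j → j < cs.length → ρ i < ρ j
  left_right : ∀ i j, i < p → p < j → j < cs.length → ρ i < ρ cs.length ∧ ρ j < ρ cs.length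

namespace Stacking

section
variable (cs : List OrderedTree) (P : ℕ → Placement) (ρ dx : ℕ → ℤ)

/-- The lowest row of the `j`-th block. -/
def low (j : ℕ) : ℤ := offset (Finset.range (cs.length + 1)) ρ (blockSize cs) j

/-- The drawing of the `j`-th subtree. -/
def sub (j : ℕ) : Placement := shift (P j) (dx j, low cs ρ j)

/-- The position of the root. -/
def origin : ℤ × ℤ := (0, low cs ρ cs.length)

end

variable {cs : List OrderedTree} {p : ℕ} {P : ℕ → Placement} {A B : ℕ → ℕ} {ρ dx : ℕ → ℤ}
  {i j k : ℕ} {t u : OrderedTree} {a : List ℕ}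

theorem lt_length (ht : cs[j]? = some t) : j < cs.length := (List.getElem?_eq_some_iff.1 ht).1

theorem blockSize_eq (ht : cs[j]? = some t) : blockSize cs j = t.size := by simp [blockSize, ht]

theorem low_add_le (hi : i ≤ cs.length) (h : ρ i < ρ j) :
    low cs ρ i + blockSize cs i ≤ low cs ρ j := by
  unfold low
  exact_mod_cast offset_add_le_offset (Finset.mem_range.2 (Nat.lt_succ_of_le hi)) h

theorem low_add_le_size (hi : i ≤ cs.length) : low cs ρ i + blockSize cs i ≤ (node cs).size := by
  unfold low
  rw [← sum_blockSize]
  exact_mod_cast offset_add_le_sum (Finset.mem_range.2 (Nat.lt_succ_of_le hi))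

theorem low_nonneg : 0 ≤ low cs ρ i := Int.natCast_nonneg _

theorem blockSize_length : blockSize cs cs.length = 1 := by simp [blockSize]

variable (h : Stacking cs p P A B ρ dx)
include h

theorem low_le_snd (ht : cs[j]? = some t) (ha : t.IsNode a) :
    low cs ρ j ≤ (sub cs P ρ dx j a).2 := by
  have := (h.layout j t ht).snd_nonneg a ha
  simp only [sub, shift, Prod.snd_add]; omega

theorem snd_lt (ht : cs[j]? = some t) (ha : t.IsNode a) :
    (sub cs P ρ dx j a).2 < low cs ρ j + blockSize cs j := by
  have := (h.layout j t ht).snd_lt a ha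
  rw [blockSize_eq ht]
  simp only [sub, shift, Prod.snd_add]; omega

theorem fst_root (ht : cs[j]? = some t) : (sub cs P ρ dx j []).1 = dx j := by
  simp [sub, shift, (h.layout j t ht).root]

theorem fst_ge (ht : cs[j]? = some t) (ha : t.IsNode a) : dx j - A j ≤ (sub cs P ρ dx j a).1 := by
  have := (h.layout j t ht).fst_ge a ha
  simp only [sub, shift, Prod.fst_add]; omega

theorem fst_le (ht : cs[j]? = some t) (ha : t.IsNode a) : (sub cs P ρ dx j a).1 ≤ dx j + B j := by
  have := (h.layout j t ht).fst_le a ha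
  simp only [sub, shift, Prod.fst_add]; omega

theorem snd_lt_snd (ht : cs[j]? = some t) (hu : cs[k]? = some u) (hjk : ρ j < ρ k) {b : List ℕ}
    (ha : t.IsNode a) (hb : u.IsNode b) : (sub cs P ρ dx j a).2 < (sub cs P ρ dx k b).2 :=
  (h.snd_lt ht ha).trans_le ((low_add_le (lt_length ht).le hjk).trans (h.low_le_snd hu hb))

theorem snd_lt_origin (ht : cs[j]? = some t) (hj : ρ j < ρ cs.length) (ha : t.IsNode a) :
    (sub cs P ρ dx j a).2 < (origin cs ρ).2 :=
  (h.snd_lt ht ha).trans_le (low_add_le (lt_length ht).le hj)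

theorem origin_lt_snd (ht : cs[j]? = some t) (hj : ρ cs.length < ρ j) (ha : t.IsNode a) :
    (origin cs ρ).2 < (sub cs P ρ dx j a).2 := by
  have h1 := low_add_le le_rfl hj
  rw [blockSize_length] at h1
  have h2 := h.low_le_snd ht ha
  simp only [origin]
  push_cast at h1
  omega

theorem rank_ne (hj : j < cs.length) : ρ j ≠ ρ cs.length :=
  fun e => hj.ne (h.rank_inj _ _ hj.le le_rfl e)

theorem snd_ne_origin (ht : cs[j]? = some t) (ha : t.IsNode a) :
    (sub cs P ρ dx j a).2 ≠ (origin cs ρ).2 := by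
  rcases lt_or_gt_of_ne (h.rank_ne (lt_length ht)) with hj | hj
  exacts [(h.snd_lt_origin ht hj ha).ne, (h.origin_lt_snd ht hj ha).ne']

theorem rank_path_root : ρ p < ρ cs.length := h.rank_path _ le_rfl h.lt.ne'

/-- Each subtree except that of the path is attached by an edge that joins adjacent columns or
adjacent rows. -/
theorem attach' (ht : cs[j]? = some t) (hj : j ≠ p) :
    (dx j = -1 ∧ B j = 0) ∨ (dx j = 1 ∧ A j = 0) ∨
      (t.IsTypeI (P j) ∧ (sub cs P ρ dx j []).2 = (origin cs ρ).2 - 1) := by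
  rcases h.attach j t ht hj with hl | hr | ⟨hI, hlt, hmax⟩
  · exact .inl hl
  · exact .inr (.inl hr)
  · refine .inr (.inr ⟨hI, ?_⟩)
    obtain ⟨a, ha, ea⟩ := (h.layout j t ht).top
    have h1 := hI a ha
    have h2 := (h.layout j t ht).snd_lt [] t.isNode_nil
    have h3 : low cs ρ cs.length = low cs ρ j + blockSize cs j := by
      unfold low
      have := offset_eq_offset_add (S := Finset.range (cs.length + 1)) (sz := blockSize cs)
        (Finset.mem_range.2 (Nat.lt_succ_of_lt (lt_length ht))) hlt (fun x hx hxj hxl => by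
          rcases Nat.lt_succ_iff_lt_or_eq.1 (Finset.mem_range.1 hx) with hx | rfl
          · exact hmax x hx hxj hxl
          · exact absurd hxl (lt_irrefl _))
      exact_mod_cast this
    rw [blockSize_eq ht] at h3
    simp only [sub, shift, origin, Prod.snd_add, h3]
    omega

theorem dx_neg (hj : j < p) : dx j ≤ -1 := by
  have := h.left j hj; omega

theorem dx_pos (hj : p < j) (hj' : j < cs.length) : 1 ≤ dx j := by
  have := h.right j hj hj'; omega

theorem slope (ht : cs[j]? = some t) (hj : j ≠ p) :
    (|dx j| = 1 ∨ (sub cs P ρ dx j []).2 - (origin cs ρ).2 = -1) := by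
  rcases h.attach' ht hj with ⟨e, -⟩ | ⟨e, -⟩ | ⟨-, e⟩
  · left; rw [e]; rfl
  · left; rw [e]; rfl
  · right; omega

/-- On each side of the path the ranks order the edges by angle. If there are subtrees on both
sides, `left_right` puts them below the root, so that angles across the path stay below π. -/
theorem cross_pos (ht : cs[j]? = some t) (hu : cs[k]? = some u) (hjk : j < k) :
    0 < cross (sub cs P ρ dx j [] - origin cs ρ) (sub cs P ρ dx k [] - origin cs ρ) := by
  have ej : (sub cs P ρ dx j [] - origin cs ρ).1 = dx j := by simp [h.fst_root ht, origin]
  have ek : (sub cs P ρ dx k [] - origin cs ρ).1 = dx k := by simp [h.fst_root hu, origin]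
  have sj := fun hj => h.slope ht hj
  have sk := fun hk => h.slope hu hk
  have nj := h.snd_ne_origin ht t.isNode_nil
  have nk := h.snd_ne_origin hu u.isNode_nil
  have hjl := lt_length ht
  have hkl := lt_length hu
  have hlow : ∀ (i : ℕ) (s : OrderedTree), cs[i]? = some s → ρ i < ρ cs.length →
      (sub cs P ρ dx i [] - origin cs ρ).2 ≤ -1 := fun i s hs hi => by
    have := h.snd_lt_origin hs hi s.isNode_nil
    simp only [Prod.snd_sub]; omega
  simp only [cross, ej, ek]
  rcases lt_trichotomy j p with hjp | rfl | hjp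
  · have dj := h.dx_neg hjp
    rcases lt_trichotomy k p with hkp | rfl | hkp
    · have dk := h.dx_neg hkp
      have hs := h.snd_lt_snd hu ht (h.left_left j k hjk hkp) u.isNode_nil t.isNode_nil
      have sj := sj hjp.ne
      have sk := sk hkp.ne
      rw [abs_of_neg (by omega)] at sj sk
      have := cross_pos_of_same_side (d := -dx j) (e := -dx k)
        (a := (sub cs P ρ dx j [] - origin cs ρ).2) (b := (sub cs P ρ dx k [] - origin cs ρ).2)
        (by omega) (by omega) sj sk (by simpa [sub_eq_zero] using nj) (by simpa using hs)
      linarith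
    · have := hlow k u hu h.rank_path_root
      rw [h.path]
      nlinarith
    · have dk := h.dx_pos hkp hkl
      obtain ⟨r1, r2⟩ := h.left_right j k hjp hkp hkl
      have h1 := hlow j t ht r1
      have h2 := hlow k u hu r2
      nlinarith
  · have := hlow j t ht h.rank_path_root
    have dk := h.dx_pos hjk hkl
    rw [h.path]
    nlinarith
  · have dj := h.dx_pos hjp hjl
    have dk := h.dx_pos (hjp.trans hjk) hkl
    have hs := h.snd_lt_snd ht hu (h.right_right j k hjp hjk hkl) t.isNode_nil u.isNode_nil
    have sj := sj hjp.ne'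
    have sk := sk (hjp.trans hjk).ne'
    rw [abs_of_pos (by omega)] at sj sk
    have := cross_pos_of_same_side (d := dx k) (e := dx j)
      (a := (sub cs P ρ dx k [] - origin cs ρ).2) (b := (sub cs P ρ dx j [] - origin cs ρ).2)
      (by omega) (by omega) sk sj (by simpa [sub_eq_zero] using nk) (by simpa using hs)
    linarith

theorem disjoint_occ_of_rank_lt (ht : cs[j]? = some t) (hu : cs[k]? = some u) (hjk : ρ j < ρ k) :
    Disjoint (Occ t (sub cs P ρ dx j)) (Occ u (sub cs P ρ dx k)) := by
  rw [Set.disjoint_left]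
  intro z hz hz'
  have h1 := snd_le_of_mem_occ (c := low cs ρ k - 1) (fun a ha => by
    have := h.snd_lt ht ha
    have := low_add_le (lt_length ht).le hjk
    omega) hz
  have h2 := le_snd_of_mem_occ (fun a ha => h.low_le_snd hu ha) hz'
  push_cast at h1
  linarith

theorem disjoint_occ (ht : cs[j]? = some t) (hu : cs[k]? = some u) (hjk : j ≠ k) :
    Disjoint (Occ t (sub cs P ρ dx j)) (Occ u (sub cs P ρ dx k)) := by
  have hne : ρ j ≠ ρ k := fun e => hjk (h.rank_inj _ _ (lt_length ht).le (lt_length hu).le e)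
  rcases lt_or_gt_of_ne hne with hlt | hlt
  exacts [h.disjoint_occ_of_rank_lt ht hu hlt, (h.disjoint_occ_of_rank_lt hu ht hlt).symm]

theorem occ_snd (hu : cs[k]? = some u) {z : ℝ × ℝ} (hz : z ∈ Occ u (sub cs P ρ dx k)) :
    z.2 ≤ (origin cs ρ).2 - 1 ∨ (origin cs ρ).2 + 1 ≤ z.2 := by
  rcases lt_or_gt_of_ne (h.rank_ne (lt_length hu)) with hk | hk
  · left
    have := snd_le_of_mem_occ (c := (origin cs ρ).2 - 1) (fun a ha => by
      have := h.snd_lt_origin hu hk ha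
      omega) hz
    exact_mod_cast this
  · right
    have := le_snd_of_mem_occ (c := (origin cs ρ).2 + 1) (fun a ha => by
      have := h.origin_lt_snd hu hk ha
      omega) hz
    exact_mod_cast this

theorem occ_fst_left (hu : cs[k]? = some u) (hk : k < p) {z : ℝ × ℝ}
    (hz : z ∈ Occ u (sub cs P ρ dx k)) : z.1 ≤ -1 := by
  have := fst_le_of_mem_occ (c := -1) (fun a ha => (h.fst_le hu ha).trans (h.left k hk)) hz
  exact_mod_cast this

theorem occ_fst_right (hu : cs[k]? = some u) (hk : p < k) {z : ℝ × ℝ}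
    (hz : z ∈ Occ u (sub cs P ρ dx k)) : 1 ≤ z.1 := by
  have := le_fst_of_mem_occ (c := 1)
    (fun a ha => (h.right k hk (lt_length hu)).trans (h.fst_ge hu ha)) hz
  exact_mod_cast this

/-- The path edge is vertical: other blocks avoid its column, and its own block does not reach above
its root there. An edge between adjacent columns has its interior in a strip free of all blocks
except that of the path, which lies lower than both ends. An edge between adjacent rows has its
interior in a strip free of all blocks. -/
theorem disjoint_star (ht : cs[j]? = some t) (hu : cs[k]? = some u) :
    Disjoint (openSegment ℝ (toPlane (origin cs ρ)) (toPlane (sub cs P ρ dx j [])))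
      (Occ u (sub cs P ρ dx k)) := by
  rw [Set.disjoint_left]
  intro z hz hz'
  obtain ⟨s, r, hs, hr, hsr, e1, e2⟩ := exists_of_mem_openSegment hz
  obtain rfl : s = 1 - r := by linarith
  have e0 : z.1 = r * dx j := by
    rw [e1, h.fst_root ht]; simp [origin]
  have e2 : z.2 = (origin cs ρ).2 + r * ((sub cs P ρ dx j []).2 - (origin cs ρ).2 : ℝ) := by
    rw [e2]; ring
  rcases eq_or_ne j p with rfl | hjp
  · rw [h.path, Int.cast_zero, mul_zero] at e0
    rcases lt_trichotomy k j with hk | rfl | hk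
    · have := h.occ_fst_left hu hk hz'
      linarith
    · have hl := h.layout k u hu
      have hfree : u.FreeAboveRoot (sub cs P ρ dx k) := fun a ha e => by
        have := hl.free a ha (by simpa [sub, shift] using e)
        simpa [sub, shift] using this
      have hglr : u.IsGLRDrawing (sub cs P ρ dx k) := hl.glr.shift _
      have h1 := snd_le_of_mem_occ_of_freeAboveRoot hglr hfree hz' (by
        rw [e0, h.fst_root hu, h.path, Int.cast_zero])
      have h2 : ((sub cs P ρ dx k []).2 : ℝ) < (origin cs ρ).2 :=
        Int.cast_lt.2 (h.snd_lt_origin hu h.rank_path_root u.isNode_nil)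
      nlinarith
    · have := h.occ_fst_right hu hk hz'
      linarith
  · rcases h.slope ht hjp with hd | hd
    · have hx : |z.1| < 1 := by
        rw [e0, abs_mul, abs_of_pos hr, ← Int.cast_abs, hd, Int.cast_one]
        linarith
      rw [abs_lt] at hx
      rcases lt_trichotomy k p with hk | rfl | hk
      · have := h.occ_fst_left hu hk hz'
        linarith
      · have hb : ∀ x : ℤ, low cs ρ k + blockSize cs k ≤ x → z.2 ≤ x - 1 := fun x hx => by
          have := snd_le_of_mem_occ (c := x - 1) (fun a ha => by
            have := h.snd_lt hu ha
            omega) hz'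
          exact_mod_cast this
        have h1 := hb _ (low_add_le h.lt.le h.rank_path_root)
        have h2 := hb _ ((low_add_le h.lt.le (h.rank_path j (lt_length ht).le hjp)).trans
          (h.low_le_snd ht t.isNode_nil))
        have e2' : z.2 = (1 - r) * ((origin cs ρ).2 : ℝ) + r * (sub cs P ρ dx j []).2 := by
          rw [e2]; ring
        have h1' : z.2 + 1 ≤ ((origin cs ρ).2 : ℝ) := by simp only [origin]; linarith
        have h2' : z.2 + 1 ≤ ((sub cs P ρ dx j []).2 : ℝ) := by linarith
        have := le_combo hs hr hsr h1' h2'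
        linarith
      · have := h.occ_fst_right hu hk hz'
        linarith
    · have hd' : ((sub cs P ρ dx j []).2 - (origin cs ρ).2 : ℝ) = -1 := by exact_mod_cast hd
      rw [hd'] at e2
      rcases h.occ_snd hu hz' with h' | h' <;> linarith

theorem isGLRDrawing : (node cs).IsGLRDrawing (place (origin cs ρ) (sub cs P ρ dx)) := by
  have hglr : ∀ (j : ℕ) (t : OrderedTree), cs[j]? = some t → t.IsGLRDrawing (sub cs P ρ dx j) :=
    fun j t ht => (h.layout j t ht).glr.shift _
  refine ⟨isPlanar_place (fun j t ht => (hglr j t ht).planar)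
    (fun j t k u ht hu hjk => h.disjoint_occ ht hu hjk) ?_
    (fun j k t u ht hu => h.disjoint_star ht hu) (fun j k t u ht hu => h.cross_pos ht hu),
    isOrderPreserving_place (fun j t ht => (hglr j t ht).ordered)
      (fun j k t u ht hu => h.cross_pos ht hu) ?_, ?_⟩
  · intro j t ht hz
    rcases h.occ_snd ht hz with h' | h' <;> simp only [toPlane] at h' <;> linarith
  · intro k t i j ht hij hj
    have hl := h.layout k t ht
    have e1 : (origin cs ρ - sub cs P ρ dx k []).1 = -dx k := by simp [h.fst_root ht, origin]
    have e2 : ρ k < ρ cs.length → 0 < (origin cs ρ - sub cs P ρ dx k []).2 := fun hk => by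
      have := h.snd_lt_origin ht hk t.isNode_nil
      simp only [Prod.snd_sub]; omega
    rw [sub, dir_shift, dir_shift, ← sub]
    rcases eq_or_ne k p with rfl | hkp
    · exact hl.ccw_of_up (by rw [e1, h.path, neg_zero]) (e2 h.rank_path_root) hij hj
    · rcases h.attach' ht hkp with ⟨hd, hB⟩ | ⟨hd, hA⟩ | ⟨hI, hrow⟩
      · rw [hB] at hl
        exact hl.ccw_of_left (by rw [e1, hd]; norm_num) hij hj
      · rw [hA] at hl
        exact hl.ccw_of_right (by rw [e1, hd]; norm_num) hij hj
      · exact hl.ccw_of_typeI hI (by simp only [Prod.snd_sub]; omega) hij hj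
  · rintro (_ | ⟨k, a⟩) ha
    · have ht : cs[p]? = some (cs[p]'h.lt) := List.getElem?_eq_getElem h.lt
      obtain ⟨b, hb⟩ := (hglr p _ ht).path [] (isNode_nil _)
      refine ⟨p :: b, isGLRPath_place_nil ht hb ?_ ?_ ?_ ?_⟩
      · rw [h.fst_root ht, h.path]; rfl
      · exact h.snd_lt_origin ht h.rank_path_root (isNode_nil _)
      · intro j u a hj hu ha
        have h1 := h.fst_le hu ha
        have h2 := h.left j hj
        simp only [origin]; omega
      · intro j u a hj hu ha
        have h1 := h.fst_ge hu ha
        have h2 := h.right j hj (lt_length hu)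
        simp only [origin]; omega
    · obtain ⟨t, ht, ha⟩ := isNode_cons.1 ha
      obtain ⟨b, hb⟩ := (hglr k t ht).path a ha
      exact ⟨k :: b, isGLRPath_place_cons ht hb⟩

theorem isLayout {A₀ B₀ : ℕ} (hA : ∀ j, j < cs.length → (A j : ℤ) - dx j ≤ A₀)
    (hB : ∀ j, j < cs.length → dx j + B j ≤ B₀) :
    (node cs).IsLayout (place (origin cs ρ) (sub cs P ρ dx)) A₀ B₀ := by
  have hp : cs[p]? = some (cs[p]'h.lt) := List.getElem?_eq_getElem h.lt
  refine ⟨h.isGLRDrawing, rfl, ?_, ?_, ?_, ?_, ?_, ?_, ?_, ?_⟩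
  · rintro (_ | ⟨j, a⟩) ha hcol
    · exact le_rfl
    · obtain ⟨t, ht, ha⟩ := isNode_cons.1 ha
      have hcol' : (sub cs P ρ dx j a).1 = 0 := hcol
      have h1 := h.fst_le ht ha
      have h2 := h.fst_ge ht ha
      rcases lt_trichotomy j p with hj | rfl | hj
      · have := h.left j hj; omega
      · exact (h.snd_lt_origin ht h.rank_path_root ha).le
      · have := h.right j hj (lt_length ht); omega
  · rintro (_ | ⟨j, a⟩) ha
    · simp [place, origin]
    · obtain ⟨t, ht, ha⟩ := isNode_cons.1 ha
      have h1 := h.fst_ge ht ha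
      have h2 := hA j (lt_length ht)
      simp only [place]; omega
  · rintro (_ | ⟨j, a⟩) ha
    · simp [place, origin]
    · obtain ⟨t, ht, ha⟩ := isNode_cons.1 ha
      have h1 := h.fst_le ht ha
      have h2 := hB j (lt_length ht)
      simp only [place]; omega
  · rintro (_ | ⟨j, a⟩) ha
    · exact low_nonneg
    · obtain ⟨t, ht, ha⟩ := isNode_cons.1 ha
      exact low_nonneg.trans (h.low_le_snd ht ha)
  · rintro (_ | ⟨j, a⟩) ha
    · have := low_add_le_size (cs := cs) (ρ := ρ) le_rfl
      rw [blockSize_length] at this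
      simp only [place, origin]
      push_cast at this
      omega
    · obtain ⟨t, ht, ha⟩ := isNode_cons.1 ha
      exact (h.snd_lt ht ha).trans_le (low_add_le_size (lt_length ht).le)
  · obtain ⟨a, ha, e⟩ := (h.layout p _ hp).bot
    refine ⟨p :: a, isNode_cons.2 ⟨_, hp, ha⟩, ?_⟩
    -- The block of the path has the least rank, so it contains row 0.
    have h0 : low cs ρ p = 0 := by
      unfold low
      rw [offset_eq_zero, Nat.cast_zero]
      intro j hj
      rcases eq_or_ne j p with rfl | hne
      · exact le_rfl
      · exact (h.rank_path j (by simpa [Nat.lt_succ_iff] using hj) hne).le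
    simp [place, sub, shift, h0, e]
  · obtain ⟨m, hm, hmax⟩ := Finset.exists_max_image (Finset.range (cs.length + 1)) ρ ⟨0, by simp⟩
    have hsum : low cs ρ m + blockSize cs m = (node cs).size := by
      unfold low
      rw [← sum_blockSize]
      exact_mod_cast offset_add_eq_sum hm fun x hx hne => lt_of_le_of_ne (hmax x hx) fun e =>
        hne (h.rank_inj _ _ (by simpa [Nat.lt_succ_iff] using hx)
          (by simpa [Nat.lt_succ_iff] using hm) e)
    rcases Nat.lt_succ_iff_lt_or_eq.1 (Finset.mem_range.1 hm) with hm | rfl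
    · have ht : cs[m]? = some cs[m] := List.getElem?_eq_getElem hm
      obtain ⟨a, ha, e⟩ := (h.layout m _ ht).top
      refine ⟨m :: a, isNode_cons.2 ⟨_, ht, ha⟩, ?_⟩
      rw [blockSize_eq ht] at hsum
      simp only [place, sub, shift, Prod.snd_add, e]
      omega
    · refine ⟨[], isNode_nil _, ?_⟩
      rw [blockSize_length] at hsum
      simp only [place, origin]
      push_cast at hsum
      omega
  · intro i j hij hj
    obtain ⟨t, ht, -⟩ := isNode_cons.1 (hj.child_of_lt hij)
    obtain ⟨u, hu, -⟩ := isNode_cons.1 hj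
    exact h.cross_pos ht hu hij

theorem isTypeI (htop : ∀ j, j < cs.length → ρ j < ρ cs.length) :
    (node cs).IsTypeI (place (origin cs ρ) (sub cs P ρ dx)) := by
  rintro (_ | ⟨j, a⟩) ha
  · exact le_rfl
  · obtain ⟨t, ht, ha⟩ := isNode_cons.1 ha
    exact (h.snd_lt_origin ht (htop j (lt_length ht)) ha).le

end Stacking

theorem IsLayout.mono {T : OrderedTree} {P : Placement} {A B A' B' : ℕ} (h : T.IsLayout P A B)
    (hA : A ≤ A') (hB : B ≤ B') : T.IsLayout P A' B' :=
  { h with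
    fst_ge := fun a ha => by have := h.fst_ge a ha; omega
    fst_le := fun a ha => by have := h.fst_le a ha; omega }

/-! ### Drawings of type I along a path with small side subtrees. -/

/-- Side subtrees hang in columns -1 and 1 and stay within `a` columns to the left and `b` to the
right. Blocks at different path nodes share these columns, so the width depends only on the largest
of them. -/
theorem exists_layout_typeI {a b : ℕ} {T : OrderedTree}
    (h : Spine (fun s => ∃ P A, s.IsLayout P A 0 ∧ A + 1 ≤ a)
      (fun s => ∃ P B, s.IsLayout P 0 B ∧ B + 1 ≤ b) T) :
    ∃ P, T.IsLayout P a b ∧ T.IsTypeI P := by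
  induction h with
  | leaf => exact ⟨_, isLayout_leaf.1.mono (Nat.zero_le _) (Nat.zero_le _), isLayout_leaf.2⟩
  | step l t r hl hr _ ih =>
    obtain ⟨Q, hQ, -⟩ := ih
    have hex : ∀ j, ∃ (P : Placement) (A B : ℕ),
        (∀ s, (l ++ t :: r)[j]? = some s → s.IsLayout P A B) ∧ (j < l.length → B = 0 ∧ A + 1 ≤ a) ∧
        (l.length < j → j < (l ++ t :: r).length → A = 0 ∧ B + 1 ≤ b) ∧
        (j = l.length → A = a ∧ B = b) := by
      intro j
      rcases lt_trichotomy j l.length with hj | rfl | hj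
      · obtain ⟨P, A, hP, hA⟩ := hl l[j] (List.getElem_mem hj)
        refine ⟨P, A, 0, fun s hs => ?_, fun _ => ⟨rfl, hA⟩, by omega, by omega⟩
        rw [List.getElem?_append_left hj, List.getElem?_eq_getElem hj, Option.some_inj] at hs
        exact hs ▸ hP
      · refine ⟨Q, a, b, fun s hs => ?_, by omega, by omega, fun _ => ⟨rfl, rfl⟩⟩
        simp only [List.getElem?_append_right le_rfl, Nat.sub_self, List.getElem?_cons_zero,
          Option.some_inj] at hs
        exact hs ▸ hQ
      · by_cases hj' : j < (l ++ t :: r).length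
        · have hmem : (l ++ t :: r)[j] ∈ r := by
            obtain ⟨i, rfl⟩ : ∃ i, j = l.length + (i + 1) := ⟨j - l.length - 1, by omega⟩
            simp
          obtain ⟨P, B, hP, hB⟩ := hr _ hmem
          refine ⟨P, 0, B, fun s hs => ?_, by omega, fun _ _ => ⟨rfl, hB⟩, by omega⟩
          rw [List.getElem?_eq_getElem hj', Option.some_inj] at hs
          exact hs ▸ hP
        · refine ⟨Q, 0, 0, fun s hs => ?_, by omega, by omega, by omega⟩
          exact absurd (List.getElem?_eq_some_iff.1 hs).1 hj'
    choose P A B hlay hleft hright hpath using hex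
    set cs := l ++ t :: r with hcs
    have hp : l.length < cs.length := by simp [hcs]
    generalize l.length = p at *
    -- From bottom to top: the path, the right subtrees in order, the left subtrees in reverse
    -- order, the root.
    have hS : Stacking cs p P A B
        (fun j => if j < p then 2 * (cs.length : ℤ) - j else if j < cs.length then j else
          3 * cs.length)
        (fun j => if j < p then -1 else if j = p then 0 else 1) := by
      refine ⟨hp, hlay, ?_, ?_, ?_, ?_, ?_, ?_, ?_, ?_, ?_⟩
      · intro i j hi hj
        split_ifs <;> omega
      · intro j hj hne
        split_ifs <;> omega
      · simp
      · intro j hj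
        have := hleft j hj
        split_ifs; omega
      · intro j hj hj'
        have := hright j hj hj'
        split_ifs <;> omega
      · intro j s hs hne
        have hj := Stacking.lt_length hs
        rcases lt_or_gt_of_ne hne with h | h
        · exact .inl ⟨if_pos h, (hleft j h).1⟩
        · exact .inr (.inl ⟨by rw [if_neg h.not_gt, if_neg hne], (hright j h hj).1⟩)
      · intro i j hij hj
        split_ifs <;> omega
      · intro i j hi hij hj
        split_ifs <;> omega
      · intro i j hi hj hj'
        constructor <;> split_ifs <;> omega
    refine ⟨_, hS.isLayout ?_ ?_, hS.isTypeI ?_⟩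
    · intro j hj
      have h1 := hleft j
      have h2 := hright j
      have h3 := hpath j
      split_ifs <;> omega
    · intro j hj
      have h1 := hleft j
      have h2 := hright j
      have h3 := hpath j
      split_ifs <;> omega
    · intro j hj
      split_ifs <;> omega

/-! ### Drawings of type II along the leftmost or rightmost path. -/

theorem size_add_size_lt {cs : List OrderedTree} {i j : ℕ} (hi : i < cs.length) (hj : j < cs.length)
    (hij : i ≠ j) : cs[i].size + cs[j].size < (node cs).size := by
  have h : ∑ x ∈ {i, j, cs.length}, blockSize cs x ≤ (node cs).size := by
    rw [← sum_blockSize]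
    refine Finset.sum_le_sum_of_subset fun x hx => ?_
    simp only [Finset.mem_insert, Finset.mem_singleton] at hx
    rw [Finset.mem_range]; omega
  rw [Finset.sum_insert (by simp; omega), Finset.sum_insert (by simp; omega), Finset.sum_singleton,
    Stacking.blockSize_eq (List.getElem?_eq_getElem hi),
    Stacking.blockSize_eq (List.getElem?_eq_getElem hj), Stacking.blockSize_length] at h
  omega

/-- At most one of the root subtrees other than the `p`-th one has more than half of the nodes. -/
theorem exists_heavy {cs : List OrderedTree} {N p : ℕ} (hN : (node cs).size ≤ N)
    (hp : p < cs.length) : ∃ m, m < cs.length ∧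
      ∀ j (hj : j < cs.length), j ≠ p → j ≠ m → 2 * cs[j].size ≤ N := by
  by_cases h : ∃ m, ∃ hm : m < cs.length, N < 2 * cs[m].size
  · obtain ⟨m, hm, h⟩ := h
    refine ⟨m, hm, fun j hj _ hjm => ?_⟩
    have := size_add_size_lt hj hm hjm
    omega
  · push Not at h
    -- If no subtree is heavy, `p` itself serves as a harmless witness.
    exact ⟨p, hp, fun j hj _ _ => h j hj⟩

theorem size_getElem_lt {cs : List OrderedTree} {j : ℕ} (hj : j < cs.length) :
    cs[j].size < (node cs).size := by
  have := size_le_sum (List.getElem_mem hj)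
  rw [size_node]; omega

/-- The path always takes child 0. The threshold `N` stays fixed while the induction descends along
the path, so the same `b` serves all path nodes. -/
theorem exists_layout_right {N b : ℕ}
    (hI : ∀ s : OrderedTree, s.size < N →
      ∃ P A B, s.IsLayout P A B ∧ s.IsTypeI P ∧ A + B + 1 ≤ b)
    (hII : ∀ s : OrderedTree, 2 * s.size ≤ N → ∃ P B, s.IsLayout P 0 B ∧ B + 1 ≤ b) :
    ∀ (n : ℕ) (T : OrderedTree), T.size ≤ n → n ≤ N → ∃ P, T.IsLayout P 0 b := by
  intro n
  induction n with
  | zero => intro T h; exact absurd T.size_pos (by omega)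
  | succ n ih =>
    rintro ⟨cs⟩ hn hN
    rcases eq_or_ne cs [] with rfl | hne
    · exact ⟨_, isLayout_leaf.1.mono le_rfl (Nat.zero_le _)⟩
    have hp : 0 < cs.length := List.length_pos_iff.2 hne
    obtain ⟨m, hm, hheavy⟩ := exists_heavy (hn.trans hN) hp
    have hex : ∀ j, ∃ (P : Placement) (A B : ℕ), (∀ s, cs[j]? = some s → s.IsLayout P A B ∧
        (j = 0 → A = 0 ∧ B = b) ∧ (j ≠ 0 → j = m → s.IsTypeI P ∧ A + B + 1 ≤ b) ∧
        (j ≠ 0 → j ≠ m → A = 0 ∧ B + 1 ≤ b)) := by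
      intro j
      by_cases hj : j < cs.length
      · have hlt := size_getElem_lt hj
        rw [List.getElem?_eq_getElem hj]
        simp only [Option.some_inj, forall_eq']
        by_cases h0 : j = 0
        · obtain ⟨P, hP⟩ := ih cs[j] (by omega) (by omega)
          exact ⟨P, 0, b, hP, fun _ => ⟨rfl, rfl⟩, by omega, by omega⟩
        · by_cases h1 : j = m
          · obtain ⟨P, A, B, hP, hP', hAB⟩ := hI cs[j] (by omega)
            exact ⟨P, A, B, hP, by omega, fun _ _ => ⟨hP', hAB⟩, by omega⟩
          · obtain ⟨P, B, hP, hB⟩ := hII cs[j] (hheavy j hj h0 h1)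
            exact ⟨P, 0, B, hP, by omega, by omega, fun _ _ => ⟨rfl, hB⟩⟩
      · exact ⟨fun _ => 0, 0, 0, fun s hs => absurd (Stacking.lt_length hs) hj⟩
    choose P A B hlay using hex
    have hnum : ∀ j, j < cs.length → (j = 0 → A j = 0 ∧ B j = b) ∧
        (j ≠ 0 → j = m → A j + B j + 1 ≤ b) ∧ (j ≠ 0 → j ≠ m → A j = 0 ∧ B j + 1 ≤ b) := by
      intro j hj
      obtain ⟨-, h1, h2, h3⟩ := hlay j _ (List.getElem?_eq_getElem hj)
      exact ⟨h1, fun h h' => (h2 h h').2, h3⟩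
    -- The odd rank `2 * m + 1` puts the root directly above block `m`, whose edge then joins
    -- adjacent rows; later children lie above the root. A heavy subtree is shifted by `A m + 1` to
    -- clear the column of the path.
    have hS : Stacking cs 0 P A B (fun j => if j = cs.length then 2 * (m : ℤ) + 1 else 2 * j)
        (fun j => if j = 0 then 0 else if j = m then (A j : ℤ) + 1 else 1) := by
      refine ⟨hp, fun j s hs => (hlay j s hs).1, ?_, ?_, ?_, ?_, ?_, ?_, ?_, ?_, ?_⟩
      · intro i j hi hj
        split_ifs <;> omega
      · intro j hj hne
        split_ifs <;> omega
      · simp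
      · intro j hj
        exact absurd hj (Nat.not_lt_zero _)
      · intro j hj hj'
        have := hnum j hj'
        split_ifs <;> omega
      · intro j s hs hne
        have hj := Stacking.lt_length hs
        obtain ⟨-, -, h2, h3⟩ := hlay j s hs
        right
        by_cases hjm : j = m
        · right
          refine ⟨(h2 hne hjm).1, ?_, ?_⟩
          · split_ifs <;> omega
          · intro i hi hij
            split_ifs <;> omega
        · left
          exact ⟨by rw [if_neg hne, if_neg hjm], (h3 hne hjm).1⟩
      · intro i j hij hj
        exact absurd hj (Nat.not_lt_zero _)
      · intro i j hi hij hj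
        split_ifs <;> omega
      · intro i j hi
        exact absurd hi (Nat.not_lt_zero _)
    refine ⟨_, hS.isLayout ?_ ?_⟩
    · intro j hj
      have := hnum j hj
      split_ifs <;> omega
    · intro j hj
      have := hnum j hj
      split_ifs <;> omega

/-- The mirror image of `exists_layout_right`: the path takes the last child, and the ranks decrease
with the index. -/
theorem exists_layout_left {N a : ℕ}
    (hI : ∀ s : OrderedTree, s.size < N →
      ∃ P A B, s.IsLayout P A B ∧ s.IsTypeI P ∧ A + B + 1 ≤ a)
    (hII : ∀ s : OrderedTree, 2 * s.size ≤ N → ∃ P A, s.IsLayout P A 0 ∧ A + 1 ≤ a) :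
    ∀ (n : ℕ) (T : OrderedTree), T.size ≤ n → n ≤ N → ∃ P, T.IsLayout P a 0 := by
  intro n
  induction n with
  | zero => intro T h; exact absurd T.size_pos (by omega)
  | succ n ih =>
    rintro ⟨cs⟩ hn hN
    rcases eq_or_ne cs [] with rfl | hne
    · exact ⟨_, isLayout_leaf.1.mono (Nat.zero_le _) le_rfl⟩
    obtain ⟨p, hp⟩ : ∃ p, cs.length = p + 1 := Nat.exists_eq_succ_of_ne_zero (by simpa using hne)
    obtain ⟨m, hm, hheavy⟩ := exists_heavy (p := p) (hn.trans hN) (by omega)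
    have hex : ∀ j, ∃ (P : Placement) (A B : ℕ), (∀ s, cs[j]? = some s → s.IsLayout P A B ∧
        (j = p → A = a ∧ B = 0) ∧ (j ≠ p → j = m → s.IsTypeI P ∧ A + B + 1 ≤ a) ∧
        (j ≠ p → j ≠ m → B = 0 ∧ A + 1 ≤ a)) := by
      intro j
      by_cases hj : j < cs.length
      · have hlt := size_getElem_lt hj
        rw [List.getElem?_eq_getElem hj]
        simp only [Option.some_inj, forall_eq']
        by_cases h0 : j = p
        · obtain ⟨P, hP⟩ := ih cs[j] (by omega) (by omega)
          exact ⟨P, a, 0, hP, fun _ => ⟨rfl, rfl⟩, by omega, by omega⟩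
        · by_cases h1 : j = m
          · obtain ⟨P, A, B, hP, hP', hAB⟩ := hI cs[j] (by omega)
            exact ⟨P, A, B, hP, by omega, fun _ _ => ⟨hP', hAB⟩, by omega⟩
          · obtain ⟨P, A, hP, hA⟩ := hII cs[j] (hheavy j hj h0 h1)
            exact ⟨P, A, 0, hP, by omega, by omega, fun _ _ => ⟨rfl, hA⟩⟩
      · exact ⟨fun _ => 0, 0, 0, fun s hs => absurd (Stacking.lt_length hs) hj⟩
    choose P A B hlay using hex
    have hnum : ∀ j, j < cs.length → (j = p → A j = a ∧ B j = 0) ∧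
        (j ≠ p → j = m → A j + B j + 1 ≤ a) ∧ (j ≠ p → j ≠ m → B j = 0 ∧ A j + 1 ≤ a) := by
      intro j hj
      obtain ⟨-, h1, h2, h3⟩ := hlay j _ (List.getElem?_eq_getElem hj)
      exact ⟨h1, fun h h' => (h2 h h').2, h3⟩
    have hS : Stacking cs p P A B (fun j => if j = cs.length then 1 - 2 * (m : ℤ) else -2 * j)
        (fun j => if j = p then 0 else if j = m then -(B j : ℤ) - 1 else -1) := by
      refine ⟨by omega, fun j s hs => (hlay j s hs).1, ?_, ?_, ?_, ?_, ?_, ?_, ?_, ?_, ?_⟩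
      · intro i j hi hj
        split_ifs <;> omega
      · intro j hj hne
        split_ifs <;> omega
      · simp
      · intro j hj
        have := hnum j (by omega)
        split_ifs <;> omega
      · intro j hj hj'
        omega
      · intro j s hs hne
        have hj := Stacking.lt_length hs
        obtain ⟨-, -, h2, h3⟩ := hlay j s hs
        by_cases hjm : j = m
        · right; right
          refine ⟨(h2 hne hjm).1, ?_, ?_⟩
          · split_ifs <;> omega
          · intro i hi hij
            split_ifs <;> omega
        · left
          exact ⟨by rw [if_neg hne, if_neg hjm], (h3 hne hjm).1⟩
      · intro i j hij hj
        split_ifs <;> omega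
      · intro i j hi hij hj
        omega
      · intro i j hi hj hj'
        omega
    refine ⟨_, hS.isLayout ?_ ?_⟩
    · intro j hj
      have := hnum j hj
      split_ifs <;> omega
    · intro j hj
      have := hnum j hj
      split_ifs <;> omega

/-! ### Widths -/

theorem rpow_size_mono {m n : ℕ} (h : m ≤ n) : (m : ℝ) ^ (0.48 : ℝ) ≤ (n : ℝ) ^ (0.48 : ℝ) :=
  Real.rpow_le_rpow (by positivity) (by exact_mod_cast h) (by norm_num)

theorem rpow_half_le {m n : ℕ} (h : 2 * m ≤ n) :
    (m : ℝ) ^ (0.48 : ℝ) ≤ 0.76 * (n : ℝ) ^ (0.48 : ℝ) := by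
  have h1 : (m : ℝ) ≤ (1 / 2) * n := by
    have : (2 * m : ℝ) ≤ n := by exact_mod_cast h
    linarith
  have h2 := rpow_le_tangent (x := 1 / 2) (x₀ := 1) (q := 1) (by norm_num) (by norm_num)
    (by norm_num) (by norm_num)
  calc (m : ℝ) ^ (0.48 : ℝ) ≤ ((1 / 2) * n) ^ (0.48 : ℝ) :=
        Real.rpow_le_rpow (by positivity) h1 (by norm_num)
    _ = (1 / 2 : ℝ) ^ (0.48 : ℝ) * (n : ℝ) ^ (0.48 : ℝ) :=
        Real.mul_rpow (by norm_num) (by positivity)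
    _ ≤ 0.76 * (n : ℝ) ^ (0.48 : ℝ) := by
        refine mul_le_mul_of_nonneg_right (h2.trans ?_) (by positivity)
        norm_num

/-- Layouts of all three types within the claimed widths. -/
theorem exists_layouts : ∀ (n : ℕ) (T : OrderedTree), T.size = n →
    (∃ P A B, T.IsLayout P A B ∧ T.IsTypeI P ∧
      (A + B + 1 : ℝ) ≤ 20000 * (n : ℝ) ^ (0.48 : ℝ) - 1) ∧
    (∃ P B, T.IsLayout P 0 B ∧ (B + 1 : ℝ) ≤ 20000 * (n : ℝ) ^ (0.48 : ℝ)) ∧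
    (∃ P A, T.IsLayout P A 0 ∧ (A + 1 : ℝ) ≤ 20000 * (n : ℝ) ^ (0.48 : ℝ)) := by
  intro n
  induction n using Nat.strong_induction_on with
  | _ n ih =>
  intro T hT
  have hn : 1 ≤ (n : ℝ) ^ (0.48 : ℝ) := by
    refine Real.one_le_rpow ?_ (by norm_num)
    have := T.size_pos
    exact_mod_cast (by omega : 1 ≤ n)
  have hpos : ∀ m : ℕ, (0 : ℝ) ≤ 20000 * (m : ℝ) ^ (0.48 : ℝ) := fun m => by positivity
  refine ⟨?_, ?_⟩
  · obtain ⟨a, b, hfit, hspine⟩ := exists_sizeSpine T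
    rw [hT] at hfit
    unfold Fits at hfit
    have ha : a < n := by
      by_contra! hle
      have := rpow_size_mono hle
      have := hpos b
      linarith
    have hb : b < n := by
      by_contra! hle
      have := rpow_size_mono hle
      have := hpos a
      linarith
    -- By induction, these floors bound the widths of the left and of the right subtrees.
    obtain ⟨P, hP, hP'⟩ := exists_layout_typeI (a := ⌊20000 * (a : ℝ) ^ (0.48 : ℝ)⌋₊)
      (b := ⌊20000 * (b : ℝ) ^ (0.48 : ℝ)⌋₊) (T := T) (by
        refine hspine.mono (fun s hs => ?_) (fun s hs => ?_)
        · obtain ⟨-, -, P, A, hP, hA⟩ := ih s.size (hs.trans_lt ha) s rfl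
          refine ⟨P, A, hP, Nat.le_floor ?_⟩
          have := rpow_size_mono hs
          push_cast
          linarith
        · obtain ⟨-, ⟨P, B, hP, hB⟩, -⟩ := ih s.size (hs.trans_lt hb) s rfl
          refine ⟨P, B, hP, Nat.le_floor ?_⟩
          have := rpow_size_mono hs
          push_cast
          linarith)
    refine ⟨P, _, _, hP, hP', ?_⟩
    have h1 := Nat.floor_le (hpos a)
    have h2 := Nat.floor_le (hpos b)
    -- The saving `0.0001 * 20000 = 2` covers the column of the path and the `- 1` of the claim,
    -- since `n ^ 0.48` is at least 1.
    linarith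
  · have hfl : 2 ≤ ⌊20000 * (n : ℝ) ^ (0.48 : ℝ)⌋₊ := Nat.le_floor (by push_cast; linarith)
    -- Column 0 belongs to the path, which leaves `b` columns beside it.
    obtain ⟨b, hb⟩ : ∃ b, ⌊20000 * (n : ℝ) ^ (0.48 : ℝ)⌋₊ = b + 1 :=
      ⟨⌊20000 * (n : ℝ) ^ (0.48 : ℝ)⌋₊ - 1, by omega⟩
    have hb' : (b + 1 : ℝ) ≤ 20000 * (n : ℝ) ^ (0.48 : ℝ) := by
      have := Nat.floor_le (hpos n)
      rw [hb] at this
      exact_mod_cast this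
    have hle : ∀ k : ℕ, (k : ℝ) ≤ 20000 * (n : ℝ) ^ (0.48 : ℝ) - 1 → k ≤ b := fun k hk => by
      have : k + 1 ≤ ⌊20000 * (n : ℝ) ^ (0.48 : ℝ)⌋₊ := Nat.le_floor (by push_cast; linarith)
      omega
    have hI : ∀ s : OrderedTree, s.size < n →
        ∃ P A B, s.IsLayout P A B ∧ s.IsTypeI P ∧ A + B + 1 ≤ b := fun s hs => by
      obtain ⟨⟨P, A, B, hP, hP', hAB⟩, -⟩ := ih s.size hs s rfl
      refine ⟨P, A, B, hP, hP', hle _ ?_⟩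
      have := rpow_size_mono hs.le
      push_cast
      linarith
    have hsmall : ∀ s : OrderedTree, 2 * s.size ≤ n → s.size < n ∧
        20000 * (s.size : ℝ) ^ (0.48 : ℝ) ≤ 20000 * (n : ℝ) ^ (0.48 : ℝ) - 1 := fun s hs => by
      have := s.size_pos
      have := rpow_half_le hs
      exact ⟨by omega, by linarith⟩
    constructor
    · obtain ⟨P, hP⟩ := exists_layout_right hI (fun s hs => by
        obtain ⟨hlt, hw⟩ := hsmall s hs
        obtain ⟨-, ⟨P, B, hP, hB⟩, -⟩ := ih s.size hlt s rfl
        exact ⟨P, B, hP, hle _ (by push_cast; linarith)⟩) n T hT.le le_rfl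
      exact ⟨P, b, hP, hb'⟩
    · obtain ⟨P, hP⟩ := exists_layout_left hI (fun s hs => by
        obtain ⟨hlt, hw⟩ := hsmall s hs
        obtain ⟨-, -, P, A, hP, hA⟩ := ih s.size hlt s rfl
        exact ⟨P, A, hP, hle _ (by push_cast; linarith)⟩) n T hT.le le_rfl
      exact ⟨P, b, hP, hb'⟩

end OrderedTree

theorem mainTheorem4 :
    ∃ c : ℝ, 0 < c ∧ ∀ T : OrderedTree,
      (∃ pos : OrderedTree.Placement, T.IsGLRDrawing pos ∧ T.IsTypeI pos ∧
        (T.width pos : ℝ) ≤ c * (T.size : ℝ) ^ (0.48 : ℝ) - 1 ∧ T.height pos = T.size) ∧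
      (∃ pos : OrderedTree.Placement, T.IsGLRDrawing pos ∧ T.IsTypeIIl pos ∧
        (T.width pos : ℝ) ≤ c * (T.size : ℝ) ^ (0.48 : ℝ) ∧ T.height pos = T.size) ∧
      (∃ pos : OrderedTree.Placement, T.IsGLRDrawing pos ∧ T.IsTypeIIr pos ∧
        (T.width pos : ℝ) ≤ c * (T.size : ℝ) ^ (0.48 : ℝ) ∧ T.height pos = T.size) := by
  refine ⟨20000, by norm_num, fun T => ?_⟩
  obtain ⟨⟨P, A, B, hP, hI, hw⟩, ⟨P₁, B₁, h₁, hw₁⟩, P₂, A₂, h₂, hw₂⟩ :=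
    OrderedTree.exists_layouts T.size T rfl
  refine ⟨⟨P, hP.glr, hI, le_trans ?_ hw, hP.height_eq⟩,
    ⟨P₁, h₁.glr, ⟨fun a ha => ?_, h₁.free⟩, le_trans ?_ hw₁, h₁.height_eq⟩,
    ⟨P₂, h₂.glr, ⟨fun a ha => ?_, h₂.free⟩, le_trans ?_ hw₂, h₂.height_eq⟩⟩
  · exact_mod_cast hP.width_le
  · have := h₁.fst_ge a ha
    have := h₁.root
    omega
  · have := h₁.width_le
    rw [zero_add] at this
    exact_mod_cast this
  · have := h₂.fst_le a ha
    have := h₂.root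
    omega
  · have := h₂.width_le
    rw [add_zero] at this
    exact_mod_cast this
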